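/- Let $k$ be an algebraically closed field of characteristic $0$. (Lie algebras.) Let $L$ be a Lie algebra over $k$, of any dimension, with center $C(L)$, and let $\{e_j\mid j\in J\}$ be a basis of $C(L)$. Let $\mathfrak g$ be the current algebra $L[x]=L\otimes_k k[x]$ or the loop algebra $L(x)=L\otimes_k k[x,x^{-1}]$, with bracket $[e\otimes a,f\otimes b]=[e,f]\otimes ab$; put $\mathbb I=\mathbb N=\{0,1,2,\dots\}$ in the first case and $\mathbb I=\mathbb Z$ in the second, and $e_{jr}=e_j\otimes x^r$. Then the center $Z(\mathfrak g)$ of the universal enveloping algebra $U(\mathfrak g)$ is the subalgebra generated by $\{e_{jr}\mid j\in J,\ r\in\mathbb I\}$, and it is freely generated by these elements, i.e. there is an isomorphism of $k$-algebras from the polynomial algebra $k[X_{jr}\mid j\in J, r\in\mathbb I]$ onto $Z(\mathfrak g)$ with $X_{jr}\mapsto e_{jr}$. (If $C(L)=0$ this says $Z(\mathfrak g)=k$.) (Lie superalgebras.) Let $L=L_{\bar 0}\oplus L_{\bar 1}$ be a Lie superalgebra over $k$, of any dimension, with center $C(L)=\{c\in L\mid [c,y]=0 \text{ for all } y\in L\}$,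 and let $\{e_j\mid j\in J\}$ be a basis of $C(L)$. Let $\mathfrak g=L[x]$ or $L(x)$ be the current or loop superalgebra, defined by the same formulas with $|e\otimes a|=|e|$, and let $\mathbb I$ and $e_{jr}$ be as above. Let $Z(\mathfrak g)=\{z\in U(\mathfrak g)\mid [z,u]=0\text{ for all }u\in U(\mathfrak g)\}$, where $U(\mathfrak g)$ is the universal enveloping superalgebra and $[z,u]$ is the bilinear extension of $[z,u]=zu-(-1)^{|z||u|}uz$ from homogeneous elements. Then $Z(\mathfrak g)$ is the subalgebra of $U(\mathfrak g)$ generated by $\{e_{jr}\mid j\in J,\ r\in\mathbb I\}$. If moreover $C(L)\subseteq L_{\bar 0}$, then $Z(\mathfrak g)$ is freely generated by these elements, i.e. there is an isomorphism of $k$-algebras from the polynomial algebra $k[X_{jr}\mid j\in J, r\in\mathbb I]$ onto $Z(\mathfrak g)$ with $X_{jr}\mapsto e_{jr}$. -/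

import Mathlib

open scoped TensorProduct DirectSum Polynomial LaurentPolynomial

noncomputable section

/-- The sign `(-1) ^ (|x| |y|)` attached to homogeneous elements of parities `i = |x|`, `j = |y|`. -/
def koszulSign (k : Type*) [Ring k] (i j : ZMod 2) : k := (-1) ^ (i.val * j.val)

/-- A Lie superalgebra over a field `k` of characteristic zero: a vector space `L` with a
decomposition `L = 𝓛 0 ⊕ 𝓛 1` into an even and an odd part, and a bilinear bracket which is
compatible with the grading, super skew-symmetric, and satisfies the super Jacobi identity.
(In characteristic zero no further axioms are needed.) -/
class LieSuperalgebra {k L : Type*} [Field k] [CharZero k] [AddCommGroup L] [Module k L]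
    (𝓛 : ZMod 2 → Submodule k L) extends DirectSum.Decomposition 𝓛 where
  /-- The Lie superbracket. -/
  bracket : L →ₗ[k] L →ₗ[k] L
  bracket_mem : ∀ ⦃i j : ZMod 2⦄ ⦃x y : L⦄, x ∈ 𝓛 i → y ∈ 𝓛 j → bracket x y ∈ 𝓛 (i + j)
  bracket_skew : ∀ ⦃i j : ZMod 2⦄ ⦃x y : L⦄, x ∈ 𝓛 i → y ∈ 𝓛 j →
    bracket x y = -(koszulSign k i j • bracket y x)
  bracket_jacobi : ∀ ⦃i j : ZMod 2⦄ ⦃x y : L⦄, x ∈ 𝓛 i → y ∈ 𝓛 j → ∀ z : L,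
    bracket x (bracket y z) =
      bracket (bracket x y) z + koszulSign k i j • bracket y (bracket x z)

/-! ### Supercommutators and the supercenter of an associative superalgebra -/

section Superalgebra

variable {k A : Type*} [CommRing k] [Ring A] [Algebra k A]
  (𝒜 : ZMod 2 → Submodule k A) [GradedAlgebra 𝒜]

/-- The supercommutator of an associative superalgebra: the biadditive extension of
`[z, u] = z u - (-1) ^ (|z| |u|) u z` from homogeneous elements to all elements. -/
def superCommutator (z u : A) : A :=
  ∑ i : ZMod 2, ∑ j : ZMod 2,
    ((DirectSum.decompose 𝒜 z i : A) * (DirectSum.decompose 𝒜 u j : A) -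
      koszulSign k i j • ((DirectSum.decompose 𝒜 u j : A) * (DirectSum.decompose 𝒜 z i : A)))

theorem superCommutator_of_mem {i j : ZMod 2} {z u : A} (hz : z ∈ 𝒜 i) (hu : u ∈ 𝒜 j) :
    superCommutator 𝒜 z u = z * u - koszulSign k i j • (u * z) := by
  unfold superCommutator
  rw [Finset.sum_eq_single i, Finset.sum_eq_single j]
  · rw [DirectSum.decompose_of_mem_same 𝒜 hz, DirectSum.decompose_of_mem_same 𝒜 hu]
  · intro b _ hb
    rw [DirectSum.decompose_of_mem_ne 𝒜 hu hb.symm]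
    simp
  · simp
  · intro b _ hb
    refine Finset.sum_eq_zero fun c _ => ?_
    rw [DirectSum.decompose_of_mem_ne 𝒜 hz hb.symm]
    simp
  · simp

theorem superCommutator_eq_zero_iff {z : A} :
    (∀ u, superCommutator 𝒜 z u = 0) ↔ ∀ i j : ZMod 2, ∀ u ∈ 𝒜 j,
      (DirectSum.decompose 𝒜 z i : A) * u =
        koszulSign k i j • (u * (DirectSum.decompose 𝒜 z i : A)) := by
  constructor
  · intro h i j u hu
    have h1 : ∑ a : ZMod 2, ((DirectSum.decompose 𝒜 z a : A) * u -
        koszulSign k a j • (u * (DirectSum.decompose 𝒜 z a : A))) = 0 := by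
      rw [← h u]
      unfold superCommutator
      refine Finset.sum_congr rfl fun a _ => ?_
      rw [Finset.sum_eq_single j]
      · rw [DirectSum.decompose_of_mem_same 𝒜 hu]
      · intro b _ hb
        rw [DirectSum.decompose_of_mem_ne 𝒜 hu hb.symm]
        simp
      · simp
    have hmem : ∀ a : ZMod 2, ((DirectSum.decompose 𝒜 z a : A) * u -
        koszulSign k a j • (u * (DirectSum.decompose 𝒜 z a : A))) ∈ 𝒜 (a + j) := fun a =>
      Submodule.sub_mem _ (SetLike.mul_mem_graded (SetLike.coe_mem _) hu)
        (Submodule.smul_mem _ _ (by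
          rw [add_comm]; exact SetLike.mul_mem_graded hu (SetLike.coe_mem _)))
    have h2 := congrArg (GradedRing.proj 𝒜 (i + j)) h1
    rw [map_sum, map_zero, Finset.sum_eq_single i] at h2
    · rw [GradedRing.proj_apply, DirectSum.decompose_of_mem_same 𝒜 (hmem i)] at h2
      exact sub_eq_zero.mp h2
    · intro b _ hb
      rw [GradedRing.proj_apply]
      exact DirectSum.decompose_of_mem_ne 𝒜 (hmem b) (fun e => hb (add_right_cancel e))
    · simp
  · intro h u
    unfold superCommutator
    refine Finset.sum_eq_zero fun i _ => Finset.sum_eq_zero fun j _ => ?_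
    rw [h i j _ (SetLike.coe_mem _), sub_self]

theorem koszulSign_add_left (a b j : ZMod 2) :
    koszulSign k (a + b) j = koszulSign k a j * koszulSign k b j := by
  have h : ∀ a b j : ZMod 2,
      ((a + b).val * j.val) % 2 = (a.val * j.val + b.val * j.val) % 2 := by decide
  unfold koszulSign
  rw [← pow_add, neg_one_pow_eq_pow_mod_two, h, ← neg_one_pow_eq_pow_mod_two]

theorem sum_univ_decompose (z : A) : ∑ i : ZMod 2, (DirectSum.decompose 𝒜 z i : A) = z := by
  induction z using DirectSum.Decomposition.inductionOn 𝒜 with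
  | zero => simp
  | homogeneous m =>
    rename_i i
    rw [Finset.sum_eq_single i]
    · rw [DirectSum.decompose_of_mem_same 𝒜 m.2]
    · intro b _ hb
      rw [DirectSum.decompose_of_mem_ne 𝒜 m.2 hb.symm]
    · simp
  | add a b ha hb =>
    conv_rhs => rw [← ha, ← hb]
    simp [Finset.sum_add_distrib]

/-- The (super)center of an associative superalgebra: all `z` with `[z, u] = 0` for every `u`,
where `[z, u]` is the supercommutator. -/
def superCenter : Subalgebra k A where
  carrier := {z | ∀ u, superCommutator 𝒜 z u = 0}
  mul_mem' := by
    intro z w hz hw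
    simp only [Set.mem_ofPred_eq, superCommutator_eq_zero_iff] at hz hw ⊢
    have key : ∀ a b i j : ZMod 2, ∀ u ∈ 𝒜 j,
        (DirectSum.decompose 𝒜 ((DirectSum.decompose 𝒜 z a : A) *
            (DirectSum.decompose 𝒜 w b : A)) i : A) * u =
          koszulSign k i j • (u * (DirectSum.decompose 𝒜 ((DirectSum.decompose 𝒜 z a : A) *
            (DirectSum.decompose 𝒜 w b : A)) i : A)) := by
      intro a b i j u hu
      have hm : (DirectSum.decompose 𝒜 z a : A) * (DirectSum.decompose 𝒜 w b : A) ∈ 𝒜 (a + b) :=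
        SetLike.mul_mem_graded (SetLike.coe_mem _) (SetLike.coe_mem _)
      by_cases e : a + b = i
      · subst e
        rw [DirectSum.decompose_of_mem_same 𝒜 hm, mul_assoc, hw b j u hu, mul_smul_comm,
          ← mul_assoc, hz a j u hu, smul_mul_assoc, smul_smul, mul_assoc,
          koszulSign_add_left, mul_comm]
      · rw [DirectSum.decompose_of_mem_ne 𝒜 hm e]
        simp
    intro i j u hu
    have hzw : z * w = ∑ a : ZMod 2, ∑ b : ZMod 2,
        (DirectSum.decompose 𝒜 z a : A) * (DirectSum.decompose 𝒜 w b : A) := by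
      rw [← Finset.sum_mul_sum]
      congr 1
      · exact (sum_univ_decompose 𝒜 z).symm
      · exact (sum_univ_decompose 𝒜 w).symm
    rw [hzw, ← GradedRing.proj_apply]
    simp only [map_sum, GradedRing.proj_apply, Finset.sum_mul, Finset.mul_sum, Finset.smul_sum]
    exact Finset.sum_congr rfl fun a _ => Finset.sum_congr rfl fun b _ => key a b i j u hu
  add_mem' := by
    intro z w hz hw
    simp only [Set.mem_ofPred_eq, superCommutator_eq_zero_iff] at hz hw ⊢
    intro i j u hu
    simp [add_mul, mul_add, hz i j u hu, hw i j u hu]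
  algebraMap_mem' := by
    intro r
    simp only [Set.mem_ofPred_eq, superCommutator_eq_zero_iff]
    intro i j u hu
    have hm : algebraMap k A r ∈ 𝒜 0 := SetLike.algebraMap_mem_graded 𝒜 r
    by_cases e : (0 : ZMod 2) = i
    · subst e
      rw [DirectSum.decompose_of_mem_same 𝒜 hm, Algebra.commutes]
      simp [koszulSign]
    · rw [DirectSum.decompose_of_mem_ne 𝒜 hm e]
      simp

end Superalgebra

namespace LieSuperalgebra

variable {k L : Type*} [Field k] [CharZero k] [AddCommGroup L] [Module k L]

/-- The center of a Lie superalgebra: all `c` with `[c, y] = 0` for every `y`. -/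
def center (𝓛 : ZMod 2 → Submodule k L) [LieSuperalgebra 𝓛] : Submodule k L :=
  LinearMap.ker (bracket 𝓛)

/-! ### Current and loop superalgebras -/

/-- The `ZMod 2`-grading of `L ⊗ A` by `𝓛 i ⊗ A`, where `A` is a purely even algebra. -/
abbrev tensorGrading (𝓛 : ZMod 2 → Submodule k L) (A : Type*) [CommRing A] [Algebra k A] :
    ZMod 2 → Submodule k (L ⊗[k] A) :=
  fun i => DirectSum.decomposeTensor 𝓛 A i

theorem tmul_mem_tensorGrading {k L : Type*} [Field k] [AddCommGroup L] [Module k L]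
    {𝓛 : ZMod 2 → Submodule k L} {A : Type*} [CommRing A] [Algebra k A] {i : ZMod 2} {x : L}
    (hx : x ∈ 𝓛 i) (a : A) : x ⊗ₜ a ∈ tensorGrading 𝓛 A i := by
  simp only [DirectSum.decomposeTensor_apply]
  exact ⟨(⟨x, hx⟩ : 𝓛 i) ⊗ₜ a, by simp⟩

theorem tensorGrading_induction {k L : Type*} [Field k] [AddCommGroup L] [Module k L]
    {𝓛 : ZMod 2 → Submodule k L} {A : Type*} [CommRing A] [Algebra k A] {i : ZMod 2}
    {p : ∀ t : L ⊗[k] A, t ∈ tensorGrading 𝓛 A i → Prop} (zero : p 0 (zero_mem _))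
    (tmul : ∀ x (hx : x ∈ 𝓛 i) (a : A), p (x ⊗ₜ a) (tmul_mem_tensorGrading hx a))
    (add : ∀ s t hs ht, p s hs → p t ht → p (s + t) (add_mem hs ht))
    (t : L ⊗[k] A) (ht : t ∈ tensorGrading 𝓛 A i) : p t ht := by
  suffices h : ∃ h, p t h from h.2
  obtain ⟨s, rfl⟩ := (by simpa only [DirectSum.decomposeTensor_apply] using ht :
    t ∈ LinearMap.range ((𝓛 i).subtype.rTensor A))
  clear ht
  induction s using TensorProduct.induction_on with
  | zero => exact ⟨by simp, by simpa using zero⟩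
  | tmul x a => exact ⟨_, tmul x x.2 a⟩
  | add s t hs ht =>
    obtain ⟨h1, h1'⟩ := hs
    obtain ⟨h2, h2'⟩ := ht
    simp only [map_add]
    exact ⟨add_mem h1 h2, add _ _ _ _ h1' h2'⟩

/-- For a Lie superalgebra `L` and a commutative algebra `A`, the Lie superalgebra `L ⊗ A` with
`|e ⊗ a| = |e|` and `[e ⊗ a, f ⊗ b] = [e, f] ⊗ a b`. For `A = k[X]` it is the current
superalgebra of `L`, for `A = k[T;T⁻¹]` it is the loop superalgebra of `L`. -/
instance tensor (𝓛 : ZMod 2 → Submodule k L) [LieSuperalgebra 𝓛] (A : Type*) [CommRing A]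
    [Algebra k A] : LieSuperalgebra (tensorGrading 𝓛 A) where
  toDecomposition := DirectSum.tensorDecomposition 𝓛 A
  bracket := TensorProduct.map₂ (bracket 𝓛) (LinearMap.mul k A)
  bracket_mem := by
    intro i j x y hx hy
    induction x, hx using tensorGrading_induction with
    | zero => simp
    | add s t _ _ hs ht => simpa using add_mem hs ht
    | tmul x hx a =>
      induction y, hy using tensorGrading_induction with
      | zero => simp
      | add s t _ _ hs ht => simpa using add_mem hs ht
      | tmul y hy b => exact tmul_mem_tensorGrading (bracket_mem hx hy) _
  bracket_skew := by
    intro i j x y hx hy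
    induction x, hx using tensorGrading_induction with
    | zero => simp
    | add s t _ _ hs ht => simp only [map_add, LinearMap.add_apply, hs, ht, smul_add, neg_add]
    | tmul x hx a =>
      induction y, hy using tensorGrading_induction with
      | zero => simp
      | add s t _ _ hs ht => simp only [map_add, LinearMap.add_apply, hs, ht, smul_add, neg_add]
      | tmul y hy b =>
        simp only [TensorProduct.map₂_apply_tmul, TensorProduct.map_tmul, LinearMap.mul_apply']
        rw [bracket_skew hx hy, mul_comm a b, TensorProduct.neg_tmul, TensorProduct.smul_tmul']
  bracket_jacobi := by
    intro i j x y hx hy z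
    induction x, hx using tensorGrading_induction with
    | zero => simp
    | add s t _ _ hs ht =>
      simp only [map_add, LinearMap.add_apply, hs, ht, smul_add]
      abel
    | tmul x hx a =>
      induction y, hy using tensorGrading_induction with
      | zero => simp
      | add s t _ _ hs ht =>
        simp only [map_add, LinearMap.add_apply, hs, ht, smul_add]
        abel
      | tmul y hy b =>
        induction z using TensorProduct.induction_on with
        | zero => simp
        | add s t hs ht =>
          simp only [map_add, hs, ht, smul_add]
          abel
        | tmul z c =>
          simp only [TensorProduct.map₂_apply_tmul, TensorProduct.map_tmul, LinearMap.mul_apply']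
          rw [bracket_jacobi hx hy, TensorProduct.add_tmul, TensorProduct.smul_tmul',
            mul_assoc, mul_left_comm b a c]

theorem tensor_bracket_tmul (𝓛 : ZMod 2 → Submodule k L) [LieSuperalgebra 𝓛] (A : Type*)
    [CommRing A] [Algebra k A] (x y : L) (a b : A) :
    bracket (tensorGrading 𝓛 A) (x ⊗ₜ a) (y ⊗ₜ b) = bracket 𝓛 x y ⊗ₜ (a * b) := rfl

/-! ### The universal enveloping superalgebra -/

variable (𝓛 : ZMod 2 → Submodule k L) [LieSuperalgebra 𝓛]

/-- The defining relations `x y - (-1) ^ (|x| |y|) y x = [x, y]` of the enveloping superalgebra,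
for homogeneous `x`, `y` in `L`. -/
inductive EnvelopingRel : TensorAlgebra k L → TensorAlgebra k L → Prop
  | of {i j : ZMod 2} {x y : L} (hx : x ∈ 𝓛 i) (hy : y ∈ 𝓛 j) :
      EnvelopingRel
        (TensorAlgebra.ι k x * TensorAlgebra.ι k y -
          koszulSign k i j • (TensorAlgebra.ι k y * TensorAlgebra.ι k x))
        (TensorAlgebra.ι k (bracket 𝓛 x y))

/-- The universal enveloping superalgebra `U(L)`. -/
def Enveloping : Type _ := RingQuot (EnvelopingRel 𝓛)

namespace Enveloping

instance : Ring (Enveloping 𝓛) := inferInstanceAs (Ring (RingQuot (EnvelopingRel 𝓛)))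

instance : Algebra k (Enveloping 𝓛) :=
  inferInstanceAs (Algebra k (RingQuot (EnvelopingRel 𝓛)))

/-- The canonical map `L → U(L)`. -/
def ι : L →ₗ[k] Enveloping 𝓛 :=
  (RingQuot.mkAlgHom k (EnvelopingRel 𝓛)).toLinearMap ∘ₗ TensorAlgebra.ι k

theorem ι_bracket {i j : ZMod 2} {x y : L} (hx : x ∈ 𝓛 i) (hy : y ∈ 𝓛 j) :
    ι 𝓛 x * ι 𝓛 y - koszulSign k i j • (ι 𝓛 y * ι 𝓛 x) = ι 𝓛 (bracket 𝓛 x y) := by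
  have := RingQuot.mkAlgHom_rel k (EnvelopingRel.of (𝓛 := 𝓛) hx hy)
  rw [map_sub, map_smul, map_mul, map_mul] at this
  exact this

/-- The existence part of the universal property of `U(L)`. -/
def lift {B : Type*} [Ring B] [Algebra k B] (f : L →ₗ[k] B)
    (hf : ∀ ⦃i j : ZMod 2⦄ ⦃x y : L⦄, x ∈ 𝓛 i → y ∈ 𝓛 j →
      f x * f y - koszulSign k i j • (f y * f x) = f (bracket 𝓛 x y)) :
    Enveloping 𝓛 →ₐ[k] B :=
  RingQuot.liftAlgHom k ⟨TensorAlgebra.lift k f, by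
    rintro _ _ ⟨hx, hy⟩
    simpa using hf hx hy⟩

theorem lift_ι {B : Type*} [Ring B] [Algebra k B] (f : L →ₗ[k] B)
    (hf : ∀ ⦃i j : ZMod 2⦄ ⦃x y : L⦄, x ∈ 𝓛 i → y ∈ 𝓛 j →
      f x * f y - koszulSign k i j • (f y * f x) = f (bracket 𝓛 x y)) (x : L) :
    lift 𝓛 f hf (ι 𝓛 x) = f x := by
  have : lift 𝓛 f hf (ι 𝓛 x) = TensorAlgebra.lift k f (TensorAlgebra.ι k x) :=
    RingQuot.liftAlgHom_mkAlgHom_apply k _ _ _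
  rw [this, TensorAlgebra.lift_ι_apply]

theorem algHom_ext {B : Type*} [Ring B] [Algebra k B] {f g : Enveloping 𝓛 →ₐ[k] B}
    (h : ∀ x, f (ι 𝓛 x) = g (ι 𝓛 x)) : f = g := by
  refine RingQuot.ringQuot_ext' k (s := EnvelopingRel 𝓛) (f := f) (g := g) ?_
  ext x
  exact h x

/-- The `ZMod 2`-grading of `U(L)`: the part of parity `i` is spanned by all products
`x₁ ⋯ xₙ` of homogeneous elements of `L` with `|x₁| + ⋯ + |xₙ| = i`. -/
def grading (i : ZMod 2) : Submodule k (Enveloping 𝓛) :=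
  Submodule.span k {u | ∃ l : List (Σ j : ZMod 2, 𝓛 j),
    (l.map Sigma.fst).sum = i ∧ (l.map fun x => ι 𝓛 (x.2 : L)).prod = u}

theorem ι_mem_grading {i : ZMod 2} {x : L} (hx : x ∈ 𝓛 i) : ι 𝓛 x ∈ grading 𝓛 i :=
  Submodule.subset_span ⟨[⟨i, x, hx⟩], by simp, by simp⟩

instance gradedMonoid : SetLike.GradedMonoid (grading 𝓛) where
  one_mem := Submodule.subset_span ⟨[], by simp, by simp⟩
  mul_mem := by
    intro i j u v hu hv
    have h : grading 𝓛 i * grading 𝓛 j ≤ grading 𝓛 (i + j) := by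
      unfold grading
      rw [Submodule.span_mul_span]
      refine Submodule.span_mono ?_
      rintro _ ⟨_, ⟨l, hl, rfl⟩, _, ⟨m, hm, rfl⟩, rfl⟩
      exact ⟨l ++ m, by simp [hl, hm], by simp⟩
    exact h (Submodule.mul_mem_mul hu hv)

/-- The canonical map from `L` to the direct sum of the graded parts of `U(L)`. -/
def gradedι : L →ₗ[k] ⨁ i, grading 𝓛 i :=
  DirectSum.toModule k (ZMod 2) _ (fun i => DirectSum.lof k (ZMod 2) (fun i => grading 𝓛 i) i ∘ₗ
    (ι 𝓛).restrict (p := 𝓛 i) (q := grading 𝓛 i) fun _ hx => ι_mem_grading 𝓛 hx) ∘ₗ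
      (DirectSum.decomposeLinearEquiv 𝓛).toLinearMap

theorem gradedι_of_mem {i : ZMod 2} {x : L} (hx : x ∈ 𝓛 i) :
    gradedι 𝓛 x = DirectSum.of (fun i => grading 𝓛 i) i ⟨ι 𝓛 x, ι_mem_grading 𝓛 hx⟩ := by
  unfold gradedι
  rw [LinearMap.comp_apply, LinearEquiv.coe_coe, DirectSum.decomposeLinearEquiv_apply,
    DirectSum.decompose_of_mem 𝓛 hx, ← DirectSum.lof_eq_of k, DirectSum.toModule_lof]
  rfl

theorem of_grading_eq {i j : ZMod 2} (h : i = j) {u v : Enveloping 𝓛} (hu : u ∈ grading 𝓛 i)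
    (hv : v ∈ grading 𝓛 j) (huv : u = v) :
    DirectSum.of (fun i => grading 𝓛 i) i ⟨u, hu⟩ =
      DirectSum.of (fun i => grading 𝓛 i) j ⟨v, hv⟩ := by
  subst h; subst huv; rfl

theorem of_mul_of_grading {i j : ZMod 2} {u v : Enveloping 𝓛} (hu : u ∈ grading 𝓛 i)
    (hv : v ∈ grading 𝓛 j) :
    DirectSum.of (fun i => grading 𝓛 i) i ⟨u, hu⟩ * DirectSum.of (fun i => grading 𝓛 i) j ⟨v, hv⟩ =
      DirectSum.of (fun i => grading 𝓛 i) (i + j) ⟨u * v, SetLike.mul_mem_graded hu hv⟩ :=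
  DirectSum.of_mul_of _ _

theorem gradedι_rel ⦃i j : ZMod 2⦄ ⦃x y : L⦄ (hx : x ∈ 𝓛 i) (hy : y ∈ 𝓛 j) :
    gradedι 𝓛 x * gradedι 𝓛 y - koszulSign k i j • (gradedι 𝓛 y * gradedι 𝓛 x) =
      gradedι 𝓛 (bracket 𝓛 x y) := by
  have hyx : ι 𝓛 y * ι 𝓛 x ∈ grading 𝓛 (i + j) := by
    rw [add_comm]
    exact SetLike.mul_mem_graded (ι_mem_grading 𝓛 hy) (ι_mem_grading 𝓛 hx)
  rw [gradedι_of_mem 𝓛 hx, gradedι_of_mem 𝓛 hy, gradedι_of_mem 𝓛 (bracket_mem hx hy),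
    of_mul_of_grading, of_mul_of_grading,
    of_grading_eq 𝓛 (add_comm j i)
      (SetLike.mul_mem_graded (ι_mem_grading 𝓛 hy) (ι_mem_grading 𝓛 hx)) hyx rfl,
    ← DirectSum.lof_eq_of k, ← DirectSum.lof_eq_of k, ← DirectSum.lof_eq_of k,
    ← map_smul, sub_eq_iff_eq_add, ← map_add]
  congr 1
  exact Subtype.ext (sub_eq_iff_eq_add.mp (ι_bracket 𝓛 hx hy))

/-- The algebra morphism from `U(L)` to the direct sum of its graded parts. -/
def gradedLift : Enveloping 𝓛 →ₐ[k] ⨁ i, grading 𝓛 i :=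
  lift 𝓛 (B := ⨁ i, grading 𝓛 i) (gradedι 𝓛) (gradedι_rel 𝓛)

theorem gradedLift_ι (x : L) : gradedLift 𝓛 (ι 𝓛 x) = gradedι 𝓛 x := by
  unfold gradedLift
  exact lift_ι (B := ⨁ i, grading 𝓛 i) 𝓛 _ _ x

/-- `U(L)` is an associative superalgebra. -/
instance gradedAlgebra : GradedAlgebra (grading 𝓛) :=
  GradedAlgebra.ofAlgHom (grading 𝓛) (gradedLift 𝓛)
    (by
      refine algHom_ext 𝓛 fun x => ?_
      rw [AlgHom.comp_apply, gradedLift_ι, AlgHom.id_apply]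
      induction x using DirectSum.Decomposition.inductionOn 𝓛 with
      | zero => simp
      | homogeneous m => rw [gradedι_of_mem 𝓛 m.2, DirectSum.coeAlgHom_of]
      | add a b ha hb => rw [map_add, map_add, map_add, ha, hb])
    (by
      rintro i ⟨u, hu⟩
      dsimp only
      induction hu using Submodule.span_induction with
      | zero => exact (map_zero _).trans (map_zero (DirectSum.of (fun i => grading 𝓛 i) i)).symm
      | add a b ha hb iha ihb =>
        rw [map_add, iha, ihb, ← map_add]
        rfl
      | smul r a ha iha =>
        rw [map_smul, iha, ← DirectSum.lof_eq_of k, ← map_smul]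
        rfl
      | mem u hu =>
        obtain ⟨l, rfl, rfl⟩ := hu
        induction l with
        | nil => exact map_one _
        | cons a l ih =>
          have hl : (l.map fun x => ι 𝓛 (x.2 : L)).prod ∈ grading 𝓛 (l.map Sigma.fst).sum :=
            Submodule.subset_span ⟨l, rfl, rfl⟩
          simp only [List.map_cons, List.prod_cons]
          rw [map_mul, ih, gradedLift_ι, gradedι_of_mem 𝓛 a.2.2, DirectSum.of_mul_of]
          rfl)

end Enveloping

end LieSuperalgebra

/-- The subalgebra `Z` is freely generated by the family `g`: it is a polynomial algebra in the
(commuting, algebraically independent) elements `g s`. -/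
def IsFreelyGeneratedBy {k A σ : Type*} [CommRing k] [Ring A] [Algebra k A]
    (Z : Subalgebra k A) (g : σ → A) : Prop :=
  ∃ φ : MvPolynomial σ k ≃ₐ[k] Z, ∀ s, (φ (MvPolynomial.X s) : A) = g s

end

/-!
The proof has two ingredients: the Poincaré–Birkhoff–Witt theorem for Lie superalgebras, and a
computation of leading terms which uses that current algebras have elements of arbitrarily large
degree.

For the Poincaré–Birkhoff–Witt theorem, take an ordered homogeneous basis of a Lie superalgebra and
call a word in it normal if it is weakly increasing and repeats no odd letter. The relators rewrite
any other word into words that are shorter, or equally long with fewer inversions. By the super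
Jacobi identity (`relator_overlap`), two ways of rewriting the same word differ by relators at
smaller words (`rel_sub_rel_mem`), so the linear form of the diamond lemma (`exists_normalForm`)
yields coordinates on the enveloping superalgebra with respect to the normal words
(`exists_normalCoord`).

Now let `z` be a supercentral element of the enveloping superalgebra of `L ⊗ A`, where `A` is
`k[X]` or `k[T;T⁻¹]` with its basis `α r` of powers of the variable. Choose a homogeneous basis of
`L` that contains a basis of the center of `L`, order the basis of `L ⊗ A` by degree first, and
write `z` in normal words of length at most `n`. Up to shorter words, the supercommutator of a word
with `y ⊗ α N` is the signed sum over the letters `β i ⊗ α r` of the word of the same word with that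
letter removed and `[β i, y] ⊗ α (r + N)` appended. If `N` is large, the new letters come after all
letters of the remaining words, so these terms are already normal and do not interfere. Hence, for
every word `m₀` of length `n - 1` and every degree `r₀`, the combination of those `β i` for which
`β i ⊗ α r₀` completes `m₀` to a word of `z` supercommutes with every `y`, and is therefore a
central element of `L`. Characteristic zero guarantees that the coefficients do not cancel
(`removeLetter_erase_ne_zero`), so all letters of the words of length `n` in `z` are central
(`mem_center_of_mem_support`). These words can be subtracted from `z`, and induction on `n` shows
that the supercenter is generated by the central letters (`superCenter_eq_adjoin`). If they are
even, the monomials in them are normal words and hence linearly independent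
(`isFreelyGeneratedBy_superCenter`).

A Lie algebra is a purely even Lie superalgebra, with the same enveloping algebra and the same
center, which gives the ordinary case (`center_envelopingAlgebra`).
-/

/-! ### Rewriting in a module with a well-founded basis -/

section NormalForm

variable {k V W S : Type*} [CommRing k] [AddCommGroup V] [Module k V]

/-- The linear form of the diamond lemma. The module `V` has a basis `e` indexed by a type `W` with
a well-founded relation, and relators `g σ` with leading term `e (lead σ)`, the rest of `g σ`
being a combination of smaller basis vectors. If any two relators with the same leading term differ
by a combination of relators with smaller leading terms, then there is a normal form map `N`: it
kills all relators, fixes the basis vectors that are not leading terms, changes a vector only by a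
combination of relators, and respects every set of basis vectors that is stable under rewriting. -/
theorem exists_normalForm (e : Module.Basis W k V) (r : W → W → Prop) (hr : WellFounded r)
    (lead : S → W) (g : S → V)
    (htail : ∀ σ, e (lead σ) - g σ ∈ Submodule.span k (e '' {w | r w (lead σ)}))
    (hconf : ∀ σ τ, lead σ = lead τ →
      g σ - g τ ∈ Submodule.span k (g '' {υ | r (lead υ) (lead σ)})) :
    ∃ N : V →ₗ[k] V, (∀ σ, N (g σ) = 0) ∧ (∀ w, (∀ σ, lead σ ≠ w) → N (e w) = e w) ∧
      (∀ v, v - N v ∈ Submodule.span k (Set.range g)) ∧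
      ∀ P : Set W, (∀ σ, lead σ ∈ P → e (lead σ) - g σ ∈ Submodule.span k (e '' P)) →
        ∀ v ∈ Submodule.span k (e '' P),
          N v ∈ Submodule.span k (e '' {w ∈ P | ∀ σ, lead σ ≠ w}) := by
  classical
  -- The recursion step: rewrite `e w` once, if possible, and apply the previously defined values.
  let step : ∀ w : W, (∀ w', r w' w → V) → V := fun w F =>
    if h : ∃ σ, lead σ = w then
      e.constr k (fun w' => if hw : r w' w then F w' hw else 0) (e w - g h.choose)
    else e w
  let n : W → V := hr.fix step
  have hn : ∀ w, n w = step w fun w' _ => n w' := fun w => hr.fix_eq step w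
  let N : V →ₗ[k] V := e.constr k n
  have hNe : ∀ w, N (e w) = n w := fun w => e.constr_basis k n w
  have hirr : ∀ w, (∀ σ, lead σ ≠ w) → N (e w) = e w := fun w h => by
    rw [hNe, hn]
    simp only [step]
    rw [dif_neg]
    rintro ⟨σ, hσ⟩
    exact h σ hσ
  -- The guard in the recursion step is harmless.
  have hred : ∀ w, (h : ∃ σ, lead σ = w) → N (e w) = N (e w - g h.choose) := fun w h => by
    rw [hNe, hn]
    simp only [step]
    rw [dif_pos h]
    have ht := htail h.choose
    rw [h.choose_spec] at ht
    generalize e w - g h.choose = t at ht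
    induction ht using Submodule.span_induction with
    | zero => simp
    | add x y _ _ hx hy => rw [map_add, map_add, hx, hy]
    | smul c x _ hx => rw [map_smul, map_smul, hx]
    | mem x hx =>
      obtain ⟨w', hw', rfl⟩ := hx
      have hw'' : r w' w := hw'
      rw [hNe, e.constr_basis, dif_pos hw'']
  have hkill : ∀ w, ∀ σ, lead σ = w → N (g σ) = 0 := fun w => by
    induction w using hr.induction with
    | _ w ih =>
    intro σ hσ
    have h : ∃ σ, lead σ = w := ⟨σ, hσ⟩
    have h1 : N (g h.choose) = 0 := by
      have := hred w h
      rwa [map_sub, eq_comm, sub_eq_self] at this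
    have h2 : Submodule.span k (g '' {υ | r (lead υ) (lead σ)}) ≤ LinearMap.ker N := by
      rw [Submodule.span_le]
      rintro _ ⟨υ, hυ, rfl⟩
      have hυ' : r (lead υ) (lead σ) := hυ
      exact ih _ (hσ ▸ hυ') υ rfl
    have h3 : N (g σ - g h.choose) = 0 := h2 (hconf σ h.choose (hσ.trans h.choose_spec.symm))
    rwa [map_sub, h1, sub_zero] at h3
  refine ⟨N, fun σ => hkill _ σ rfl, hirr, fun v => ?_, fun P hP v hv => ?_⟩
  · have key : ∀ w, e w - N (e w) ∈ Submodule.span k (Set.range g) := fun w => by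
      induction w using hr.induction with
      | _ w ih =>
      by_cases h : ∃ σ, lead σ = w
      · obtain ⟨σ, rfl⟩ := h
        have h1 : N (e (lead σ)) = N (e (lead σ) - g σ) := by rw [map_sub, hkill _ σ rfl, sub_zero]
        have h2 : ∀ t ∈ Submodule.span k (e '' {w | r w (lead σ)}),
            t - N t ∈ Submodule.span k (Set.range g) := fun t ht => by
          induction ht using Submodule.span_induction with
          | zero => simp
          | add x y _ _ hx hy => rw [map_add, add_sub_add_comm]; exact add_mem hx hy
          | smul c x _ hx => rw [map_smul, ← smul_sub]; exact Submodule.smul_mem _ _ hx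
          | mem x hx =>
            obtain ⟨w', hw', rfl⟩ := hx
            exact ih w' hw'
        have h3 := add_mem (h2 _ (htail σ))
          (Submodule.subset_span ⟨σ, rfl⟩ : g σ ∈ Submodule.span k (Set.range g))
        rw [h1]
        convert h3 using 1
        abel
      · push Not at h
        rw [hirr w h, sub_self]
        exact zero_mem _
    rw [← e.linearCombination_repr v, Finsupp.linearCombination_apply, Finsupp.sum, map_sum,
      ← Finset.sum_sub_distrib]
    refine sum_mem fun w _ => ?_
    rw [map_smul, ← smul_sub]
    exact Submodule.smul_mem _ _ (key w)
  · have key : ∀ w ∈ P, N (e w) ∈ Submodule.span k (e '' {w ∈ P | ∀ σ, lead σ ≠ w}) := fun w => by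
      induction w using hr.induction with
      | _ w ih =>
      intro hw
      by_cases h : ∃ σ, lead σ = w
      · obtain ⟨σ, rfl⟩ := h
        have h1 : N (e (lead σ)) = N (e (lead σ) - g σ) := by rw [map_sub, hkill _ σ rfl, sub_zero]
        rw [h1]
        -- The tail is supported both on smaller vectors and on `P`, hence on the intersection.
        have h2 := hP σ hw
        have h3 := htail σ
        rw [e.mem_span_image] at h2 h3
        have h4 : e (lead σ) - g σ ∈ Submodule.span k (e '' ({w | r w (lead σ)} ∩ P)) :=
          e.mem_span_image.mpr (Set.subset_inter h3 h2)
        have h5 : Submodule.span k (e '' ({w | r w (lead σ)} ∩ P)) ≤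
            (Submodule.span k (e '' {w ∈ P | ∀ σ, lead σ ≠ w})).comap N := by
          rw [Submodule.span_le]
          rintro _ ⟨w', ⟨hw', hw''⟩, rfl⟩
          exact ih w' hw' hw''
        exact h5 h4
      · push Not at h
        rw [hirr w h]
        exact Submodule.subset_span ⟨w, ⟨hw, h⟩, rfl⟩
    have h5 : Submodule.span k (e '' P) ≤
        (Submodule.span k (e '' {w ∈ P | ∀ σ, lead σ ≠ w})).comap N := by
      rw [Submodule.span_le]
      rintro _ ⟨w', hw', rfl⟩
      exact key w' hw'
    exact h5 hv

end NormalForm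

noncomputable section

/-! ### Koszul signs -/

section KoszulSign

variable {k : Type*} [CommRing k]

theorem koszulSign_comm (i j : ZMod 2) : koszulSign k i j = koszulSign k j i := by
  unfold koszulSign
  rw [mul_comm]

theorem koszulSign_add_right (i a b : ZMod 2) :
    koszulSign k i (a + b) = koszulSign k i a * koszulSign k i b := by
  rw [koszulSign_comm, koszulSign_add_left, koszulSign_comm a, koszulSign_comm b]

theorem koszulSign_eq_or (i j : ZMod 2) : koszulSign k i j = 1 ∨ koszulSign k i j = -1 :=
  neg_one_pow_eq_or k _

theorem koszulSign_mul_self (i j : ZMod 2) : koszulSign k i j * koszulSign k i j = 1 := by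
  rcases koszulSign_eq_or (k := k) i j with h | h <;> rw [h] <;> simp

theorem koszulSign_one_one : koszulSign k 1 1 = -1 := by
  simp [koszulSign, ZMod.val_one]

theorem koszulSign_zero_left (j : ZMod 2) : koszulSign k 0 j = 1 := by
  simp [koszulSign]

end KoszulSign

/-! ### The defining relators of the enveloping superalgebra -/

namespace LieSuperalgebra

section Relator

variable {k V : Type*} [Field k] [CharZero k] [AddCommGroup V] [Module k V]
  (𝓥 : ZMod 2 → Submodule k V) [LieSuperalgebra 𝓥]

/-- The relator `v w - (-1) ^ (i j) w v - [v, w]` in the tensor algebra. It is defined for all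
`v`, `w` and all parities `i`, `j`, but is meaningful only for `v ∈ 𝓥 i` and `w ∈ 𝓥 j`. -/
def relator (i j : ZMod 2) (v w : V) : TensorAlgebra k V :=
  TensorAlgebra.ι k v * TensorAlgebra.ι k w
    - koszulSign k i j • (TensorAlgebra.ι k w * TensorAlgebra.ι k v)
    - TensorAlgebra.ι k (bracket 𝓥 v w)

variable {𝓥}

theorem relator_skew {i j : ZMod 2} {v w : V} (hv : v ∈ 𝓥 i) (hw : w ∈ 𝓥 j) :
    relator 𝓥 i j v w = -(koszulSign k i j • relator 𝓥 j i w v) := by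
  unfold relator
  rw [bracket_skew hv hw, koszulSign_comm j i, map_neg, map_smul]
  rcases koszulSign_eq_or (k := k) i j with h | h <;> rw [h] <;> module

theorem relator_self_of_even {v : V} (hv : v ∈ 𝓥 0) : relator 𝓥 0 0 v v = 0 := by
  have h := relator_skew hv hv
  rw [koszulSign_zero_left, one_smul] at h
  have h2 : (2 : k) • relator 𝓥 0 0 v v = 0 := by
    linear_combination (norm := module) h
  exact (smul_eq_zero.mp h2).resolve_left two_ne_zero

/-- The resolution of the overlap `u v w` of two relators: by the super Jacobi identity, the
difference of the two ways to rewrite `u v w` is a combination of relators at the five other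
permutations of `u v w` and of relators of lower length. -/
theorem relator_overlap {i j l : ZMod 2} {u v w : V} (hu : u ∈ 𝓥 i) (hv : v ∈ 𝓥 j) :
    relator 𝓥 i j u v * TensorAlgebra.ι k w - TensorAlgebra.ι k u * relator 𝓥 j l v w =
      -(koszulSign k i j • (TensorAlgebra.ι k v * relator 𝓥 i l u w))
      - (koszulSign k i j * koszulSign k i l) • (relator 𝓥 j l v w * TensorAlgebra.ι k u)
      + koszulSign k j l • (relator 𝓥 i l u w * TensorAlgebra.ι k v)
      + (koszulSign k j l * koszulSign k i l) • (TensorAlgebra.ι k w * relator 𝓥 i j u v)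
      - relator 𝓥 (i + j) l (bracket 𝓥 u v) w
      + relator 𝓥 i (j + l) u (bracket 𝓥 v w)
      - koszulSign k i j • relator 𝓥 j (i + l) v (bracket 𝓥 u w) := by
  have hJ := congrArg (TensorAlgebra.ι k) (bracket_jacobi hu hv w)
  rw [map_add, map_smul] at hJ
  unfold relator
  rw [koszulSign_add_left, koszulSign_add_right, koszulSign_add_right, koszulSign_comm j i]
  simp only [mul_sub, sub_mul, mul_smul_comm, smul_mul_assoc, mul_assoc]
  rcases koszulSign_eq_or (k := k) i j with h | h <;>
  rcases koszulSign_eq_or (k := k) i l with h' | h' <;>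
  rcases koszulSign_eq_or (k := k) j l with h'' | h'' <;>
  rw [h] at hJ ⊢ <;> rw [h', h''] <;> linear_combination (norm := module) hJ

end Relator

/-! ### Words in a homogeneous basis -/

section Words

variable {k V X : Type*} [Field k] [AddCommGroup V] [Module k V] (b : Module.Basis X k V)

/-- The product of the basis vectors named by the letters of a word, in the tensor algebra. -/
def word (l : List X) : TensorAlgebra k V := (l.map fun x => TensorAlgebra.ι k (b x)).prod

@[simp]
theorem word_nil : word b [] = 1 := rfl

@[simp]
theorem word_cons (x : X) (l : List X) :
    word b (x :: l) = TensorAlgebra.ι k (b x) * word b l := by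
  simp [word]

@[simp]
theorem word_append (l m : List X) : word b (l ++ m) = word b l * word b m := by
  simp [word]

/-- The words form a basis of the tensor algebra. -/
def wordBasis : Module.Basis (List X) k (TensorAlgebra k V) :=
  b.tensorAlgebra.reindex FreeMonoid.toList

theorem wordBasis_apply (l : List X) : wordBasis b l = word b l := by
  have h : wordBasis b l = (TensorAlgebra.equivFreeAlgebra b).symm
      (FreeAlgebra.equivMonoidAlgebraFreeMonoid.symm
        (MonoidAlgebra.single (FreeMonoid.ofList l) (1 : k))) := by
    simp [wordBasis, Module.Basis.tensorAlgebra, FreeAlgebra.basisFreeMonoid]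
  rw [h]
  clear h
  induction l with
  | nil =>
    rw [FreeMonoid.ofList_nil, ← MonoidAlgebra.one_def, map_one, map_one, word_nil]
  | cons x l ih =>
    rw [word_cons, ← ih, FreeMonoid.ofList_cons]
    have h1 : (MonoidAlgebra.single (FreeMonoid.of x * FreeMonoid.ofList l) (1 : k)) =
        MonoidAlgebra.single (FreeMonoid.of x) 1 * MonoidAlgebra.single (FreeMonoid.ofList l) 1 := by
      rw [MonoidAlgebra.single_mul_single, one_mul]
    rw [h1, map_mul, map_mul]
    congr 1
    rw [← TensorAlgebra.equivFreeAlgebra_symm_ι b x]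
    congr 1
    simp [FreeAlgebra.equivMonoidAlgebraFreeMonoid]

end Words

end LieSuperalgebra
end

noncomputable section

namespace LieSuperalgebra

/-! ### The order on words -/

section Inversions

variable {X : Type*} [LinearOrder X]

/-- The number of inversions of a word. -/
def inversions : List X → ℕ
  | [] => 0
  | x :: l => l.countP (· < x) + inversions l

theorem inversions_swap (a : List X) {x y : X} (h : y < x) (c : List X) :
    inversions (a ++ y :: x :: c) + 1 = inversions (a ++ x :: y :: c) := by
  induction a with
  | nil =>
    simp only [List.nil_append, inversions, List.countP_cons]
    simp [h, not_lt.mpr h.le]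
    omega
  | cons z a ih =>
    simp only [List.cons_append, inversions]
    have : (a ++ y :: x :: c).countP (· < z) = (a ++ x :: y :: c).countP (· < z) :=
      (List.Perm.append_left a (List.Perm.swap x y c)).countP_eq _
    omega

/-- Words are compared first by length, then by their number of inversions. -/
def WordLT : List X → List X → Prop :=
  InvImage (Prod.Lex (· < ·) (· < ·)) fun l => (l.length, inversions l)

/-- Rewriting terminates. -/
theorem wordLT_wf : WellFounded (WordLT (X := X)) :=
  InvImage.wf _ (WellFounded.prod_lex wellFounded_lt wellFounded_lt)

theorem wordLT_iff {l m : List X} :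
    WordLT l m ↔ l.length < m.length ∨ l.length = m.length ∧ inversions l < inversions m := by
  simp [WordLT, InvImage, Prod.lex_def]

end Inversions

/-! ### The Poincaré–Birkhoff–Witt relators and their confluence -/

section HomogeneousBasis

variable {k V X : Type*} [Field k] [AddCommGroup V] [Module k V] {𝓥 : ZMod 2 → Submodule k V}
  [DirectSum.Decomposition 𝓥] {b : Module.Basis X k V} {p : X → ZMod 2}

theorem mem_span_basis_of_mem (hb : ∀ x, b x ∈ 𝓥 (p x)) {i : ZMod 2} {v : V} (hv : v ∈ 𝓥 i) :
    v ∈ Submodule.span k (b '' {x | p x = i}) := by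
  classical
  have h := b.linearCombination_repr v
  rw [Finsupp.linearCombination_apply, Finsupp.sum] at h
  have h2 := congrArg (fun u => (DirectSum.decompose 𝓥 u i : V)) h
  simp only [DirectSum.decompose_sum, DirectSum.decompose_smul, DirectSum.decompose_of_mem_same 𝓥 hv]
    at h2
  rw [← h2, DFinsupp.finsetSum_apply, AddSubmonoidClass.coe_finsetSum]
  refine sum_mem fun x _ => ?_
  rw [DirectSum.smul_apply, Submodule.coe_smul]
  refine Submodule.smul_mem _ _ ?_
  by_cases hx : p x = i
  · rw [DirectSum.decompose_of_mem_same 𝓥 (hx ▸ hb x)]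
    exact Submodule.subset_span ⟨x, hx, rfl⟩
  · rw [DirectSum.decompose_of_mem_ne 𝓥 (hb x) hx]
    exact zero_mem _

end HomogeneousBasis

section Confluence

variable {k V X : Type*} [Field k] [CharZero k] [AddCommGroup V] [Module k V]
  (𝓥 : ZMod 2 → Submodule k V) [LieSuperalgebra 𝓥] (b : Module.Basis X k V) (p : X → ZMod 2)
  [LinearOrder X]

/-- The pairs of neighbouring letters that may not occur in a normal word: those in the wrong order,
and repeated odd letters. -/
def IsDescent (x y : X) : Prop := y < x ∨ x = y ∧ p x = 1

/-- A word with a marked descent `x y`: the word is `a x y c`. -/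
structure Descent where
  /-- The part before the descent. -/
  a : List X
  /-- The first letter of the descent. -/
  x : X
  /-- The second letter of the descent. -/
  y : X
  /-- The part after the descent. -/
  c : List X
  isDescent : IsDescent p x y

variable {p} in
/-- The word in which the descent is marked. -/
def Descent.lead (s : Descent p) : List X := s.a ++ s.x :: s.y :: s.c

/-- The relator that rewrites the marked descent, normalized to have leading coefficient `1`; since
`relator x x = 2 x x - [x, x]` for odd `x`, this requires a division by `2` for repeated letters. -/
def Descent.rel (s : Descent p) : TensorAlgebra k V :=
  word b s.a * ((if s.y < s.x then (1 : k) else 2⁻¹) •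
    relator 𝓥 (p s.x) (p s.y) (b s.x) (b s.y)) * word b s.c

/-- The span of the normalized relators with leading word in `S`. -/
def relatorsIn (S : Set (List X)) : Submodule k (TensorAlgebra k V) :=
  Submodule.span k (Descent.rel 𝓥 b p '' {s | s.lead ∈ S})

variable {𝓥 b p}

theorem mem_relatorsIn_of_isDescent {S : Set (List X)} {a c : List X} {x y : X}
    (h : IsDescent p x y) (hw : a ++ x :: y :: c ∈ S) :
    word b a * relator 𝓥 (p x) (p y) (b x) (b y) * word b c ∈ relatorsIn 𝓥 b p S := by
  have h1 : Descent.rel 𝓥 b p ⟨a, x, y, c, h⟩ ∈ relatorsIn 𝓥 b p S :=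
    Submodule.subset_span ⟨_, hw, rfl⟩
  simp only [Descent.rel, mul_smul_comm, smul_mul_assoc] at h1
  refine ((relatorsIn 𝓥 b p S).smul_mem_iff ?_).mp h1
  split_ifs <;> norm_num

theorem sub_descent_rel {x y : X} (h : IsDescent p x y) :
    TensorAlgebra.ι k (b x) * TensorAlgebra.ι k (b y) - (if y < x then (1 : k) else 2⁻¹) •
        relator 𝓥 (p x) (p y) (b x) (b y) =
      if y < x then koszulSign k (p x) (p y) • (TensorAlgebra.ι k (b y) * TensorAlgebra.ι k (b x)) +
          TensorAlgebra.ι k (bracket 𝓥 (b x) (b y))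
        else (2⁻¹ : k) • TensorAlgebra.ι k (bracket 𝓥 (b x) (b y)) := by
  unfold relator
  rcases h with h | ⟨rfl, h⟩
  · rw [if_pos h, if_pos h]
    module
  · rw [if_neg (lt_irrefl _), if_neg (lt_irrefl _), h, koszulSign_one_one]
    module

/-- Two descents of a word that do not overlap: both ways of rewriting lead to the word in which
both descents have been rewritten, and the relators used for this have smaller leading words. -/
theorem disjoint_mem_relatorsIn (a d c : List X) {x y z t : X} (hxy : IsDescent p x y)
    (hzt : IsDescent p z t) :
    Descent.rel 𝓥 b p ⟨a, x, y, d ++ z :: t :: c, hxy⟩ -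
        Descent.rel 𝓥 b p ⟨a ++ x :: y :: d, z, t, c, hzt⟩ ∈
      relatorsIn 𝓥 b p {u | WordLT u (a ++ x :: y :: (d ++ z :: t :: c))} := by
  set Q := relatorsIn 𝓥 b p {u | WordLT u (a ++ x :: y :: (d ++ z :: t :: c))} with hQ
  -- What remains of `x y` and of `z t` after rewriting.
  set s₁ := TensorAlgebra.ι k (b x) * TensorAlgebra.ι k (b y) - (if y < x then (1 : k) else 2⁻¹) •
    relator 𝓥 (p x) (p y) (b x) (b y) with hs₁
  set s₂ := TensorAlgebra.ι k (b z) * TensorAlgebra.ι k (b t) - (if t < z then (1 : k) else 2⁻¹) •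
    relator 𝓥 (p z) (p t) (b z) (b t) with hs₂
  have e₁ := sub_descent_rel (𝓥 := 𝓥) (b := b) hxy
  have e₂ := sub_descent_rel (𝓥 := 𝓥) (b := b) hzt
  rw [← hs₁] at e₁
  rw [← hs₂] at e₂
  have h₁ : word b a * relator 𝓥 (p x) (p y) (b x) (b y) * word b d * s₂ * word b c ∈ Q := by
    have hB : ∀ v : V, word b a * relator 𝓥 (p x) (p y) (b x) (b y) * word b d *
        TensorAlgebra.ι k v * word b c ∈ Q := by
      intro v
      have hv := b.mem_span v
      induction hv using Submodule.span_induction with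
      | zero => simp
      | add v w _ _ hv hw =>
        rw [map_add, mul_add, add_mul]
        exact add_mem hv hw
      | smul r v _ hv =>
        rw [map_smul, mul_smul_comm, smul_mul_assoc]
        exact Q.smul_mem r hv
      | mem v hv =>
        obtain ⟨u, rfl⟩ := hv
        have := mem_relatorsIn_of_isDescent (𝓥 := 𝓥) (b := b) (a := a) (c := d ++ u :: c) hxy
          (S := {u | WordLT u (a ++ x :: y :: (d ++ z :: t :: c))}) (wordLT_iff.mpr (Or.inl (by simp)))
        simpa [mul_assoc] using this
    rw [e₂]
    split_ifs with h
    · have := mem_relatorsIn_of_isDescent (𝓥 := 𝓥) (b := b) (a := a) (c := d ++ t :: z :: c) hxy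
          (S := {u | WordLT u (a ++ x :: y :: (d ++ z :: t :: c))}) (by
            refine wordLT_iff.mpr (Or.inr ?_)
            have := inversions_swap (a ++ x :: y :: d) h c
            simp only [List.append_assoc, List.cons_append] at this
            exact ⟨by simp, by omega⟩)
      convert add_mem (Q.smul_mem (koszulSign k (p z) (p t)) this) (hB (bracket 𝓥 (b z) (b t)))
        using 1
      simp [mul_add, add_mul, mul_assoc]
    · convert Q.smul_mem (2⁻¹ : k) (hB (bracket 𝓥 (b z) (b t))) using 1
      simp
  have h₂ : word b a * s₁ * word b d * relator 𝓥 (p z) (p t) (b z) (b t) * word b c ∈ Q := by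
    have hB : ∀ v : V, word b a * TensorAlgebra.ι k v * word b d *
        relator 𝓥 (p z) (p t) (b z) (b t) * word b c ∈ Q := by
      intro v
      have hv := b.mem_span v
      induction hv using Submodule.span_induction with
      | zero => simp
      | add v w _ _ hv hw =>
        rw [map_add, mul_add, add_mul, add_mul, add_mul]
        exact add_mem hv hw
      | smul r v _ hv =>
        rw [map_smul, mul_smul_comm, smul_mul_assoc, smul_mul_assoc, smul_mul_assoc]
        exact Q.smul_mem r hv
      | mem v hv =>
        obtain ⟨u, rfl⟩ := hv
        have := mem_relatorsIn_of_isDescent (𝓥 := 𝓥) (b := b) (a := a ++ u :: d) (c := c) hzt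
          (S := {u | WordLT u (a ++ x :: y :: (d ++ z :: t :: c))}) (wordLT_iff.mpr (Or.inl (by simp)))
        simpa [mul_assoc] using this
    rw [e₁]
    split_ifs with h
    · have := mem_relatorsIn_of_isDescent (𝓥 := 𝓥) (b := b) (a := a ++ y :: x :: d) (c := c) hzt
          (S := {u | WordLT u (a ++ x :: y :: (d ++ z :: t :: c))}) (by
            refine wordLT_iff.mpr (Or.inr ?_)
            have := inversions_swap a h (d ++ z :: t :: c)
            simp only [List.append_assoc, List.cons_append]
            exact ⟨by simp, by omega⟩)
      convert add_mem (Q.smul_mem (koszulSign k (p x) (p y)) this) (hB (bracket 𝓥 (b x) (b y)))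
        using 1
      simp [mul_add, add_mul, mul_assoc]
    · convert Q.smul_mem (2⁻¹ : k) (hB (bracket 𝓥 (b x) (b y))) using 1
      simp
  convert sub_mem (Q.smul_mem (if y < x then (1 : k) else 2⁻¹) h₁)
    (Q.smul_mem (if t < z then (1 : k) else 2⁻¹) h₂) using 1
  rw [hs₁, hs₂]
  simp only [Descent.rel, word_append, word_cons, mul_sub, sub_mul, mul_smul_comm, smul_mul_assoc,
    mul_assoc]
  module

theorem word_lead_sub_rel_mem (s : Descent p) :
    word b s.lead - Descent.rel 𝓥 b p s ∈
      Submodule.span k (word b '' {w | WordLT w s.lead}) := by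
  obtain ⟨a, x, y, c, h⟩ := s
  have h1 : word b (Descent.lead ⟨a, x, y, c, h⟩) - Descent.rel 𝓥 b p ⟨a, x, y, c, h⟩ =
      word b a * (TensorAlgebra.ι k (b x) * TensorAlgebra.ι k (b y) -
        (if y < x then (1 : k) else 2⁻¹) • relator 𝓥 (p x) (p y) (b x) (b y)) * word b c := by
    simp [Descent.lead, Descent.rel, mul_sub, sub_mul, mul_assoc]
  rw [h1, sub_descent_rel h]
  have hB : ∀ v : V, word b a * TensorAlgebra.ι k v * word b c ∈
      Submodule.span k (word b '' {w | WordLT w (Descent.lead ⟨a, x, y, c, h⟩)}) := by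
    intro v
    have hv := b.mem_span v
    induction hv using Submodule.span_induction with
    | zero => simp
    | add v w _ _ hv hw =>
      rw [map_add, mul_add, add_mul]
      exact add_mem hv hw
    | smul r v _ hv =>
      rw [map_smul, mul_smul_comm, smul_mul_assoc]
      exact Submodule.smul_mem _ r hv
    | mem v hv =>
      obtain ⟨u, rfl⟩ := hv
      refine Submodule.subset_span ⟨a ++ u :: c, ?_, by simp [mul_assoc]⟩
      exact wordLT_iff.mpr (Or.inl (by simp [Descent.lead]))
  split_ifs with h'
  · rw [mul_add, add_mul]
    refine add_mem ?_ (hB _)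
    rw [mul_smul_comm, smul_mul_assoc]
    refine Submodule.smul_mem _ _ (Submodule.subset_span ⟨a ++ y :: x :: c, ?_, by simp [mul_assoc]⟩)
    refine wordLT_iff.mpr (Or.inr ⟨by simp [Descent.lead], ?_⟩)
    have := inversions_swap a h' c
    simp only [Descent.lead]
    omega
  · rw [mul_smul_comm, smul_mul_assoc]
    exact Submodule.smul_mem _ _ (hB _)

variable (hb : ∀ x, b x ∈ 𝓥 (p x))
include hb

theorem mem_relatorsIn {S : Set (List X)} {a c : List X} {x y : X}
    (hxy : a ++ x :: y :: c ∈ S) (hyx : a ++ y :: x :: c ∈ S) :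
    word b a * relator 𝓥 (p x) (p y) (b x) (b y) * word b c ∈ relatorsIn 𝓥 b p S := by
  rcases lt_trichotomy y x with h | h | h
  · exact mem_relatorsIn_of_isDescent (Or.inl h) hxy
  · subst h
    by_cases hp : p y = 1
    · exact mem_relatorsIn_of_isDescent (Or.inr ⟨rfl, hp⟩) hxy
    · have hp0 : p y = 0 := by
        generalize p y = q at hp
        revert q
        decide
      have hy := hb y
      rw [hp0] at hy ⊢
      rw [relator_self_of_even hy]
      simp
  · rw [relator_skew (hb x) (hb y), mul_neg, neg_mul, mul_smul_comm, smul_mul_assoc]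
    exact neg_mem (Submodule.smul_mem _ _ (mem_relatorsIn_of_isDescent (Or.inl h) hyx))

/-- By bilinearity, the relators of all homogeneous elements are combinations of those of the basis
vectors. -/
theorem homogeneous_relator_mem {S : Set (List X)} {a c : List X}
    (hS : ∀ x y, a ++ x :: y :: c ∈ S) {i j : ZMod 2} {u v : V} (hu : u ∈ 𝓥 i) (hv : v ∈ 𝓥 j) :
    word b a * relator 𝓥 i j u v * word b c ∈ relatorsIn 𝓥 b p S := by
  have hu' := mem_span_basis_of_mem hb hu
  have hv' := mem_span_basis_of_mem hb hv
  clear hu hv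
  induction hu' using Submodule.span_induction with
  | zero => simp [relator]
  | add s t _ _ hs ht =>
    convert add_mem hs ht using 1
    simp only [relator, map_add, LinearMap.add_apply, add_mul, mul_add, smul_add, mul_sub, sub_mul]
    abel
  | smul r s _ hs =>
    convert Submodule.smul_mem _ r hs using 1
    simp only [relator, map_smul, LinearMap.smul_apply, smul_mul_assoc, mul_smul_comm, mul_sub,
      sub_mul, smul_sub]
    rw [smul_comm r]
  | mem s hs =>
    obtain ⟨x, rfl, rfl⟩ := hs
    induction hv' using Submodule.span_induction with
    | zero => simp [relator]
    | add s t _ _ hs ht =>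
      convert add_mem hs ht using 1
      simp only [relator, map_add, add_mul, mul_add, smul_add, mul_sub, sub_mul]
      abel
    | smul r s _ hs =>
      convert Submodule.smul_mem _ r hs using 1
      simp only [relator, map_smul, smul_mul_assoc, mul_smul_comm, mul_sub, sub_mul, smul_sub]
      rw [smul_comm r]
    | mem s hs =>
      obtain ⟨y, rfl, rfl⟩ := hs
      exact mem_relatorsIn hb (hS x y) (hS y x)

/-- Two overlapping descents `x y` and `y z` of a word. Depending on whether `x`, `y` and `z` are
distinct, some of the permutations in `relator_overlap` coincide with the given word. -/
theorem overlap_mem_relatorsIn (a c : List X) {x y z : X} (hxy : IsDescent p x y)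
    (hyz : IsDescent p y z) :
    Descent.rel 𝓥 b p ⟨a, x, y, z :: c, hxy⟩ - Descent.rel 𝓥 b p ⟨a ++ [x], y, z, c, hyz⟩ ∈
      relatorsIn 𝓥 b p {u | WordLT u (a ++ x :: y :: z :: c)} := by
  set Q := relatorsIn 𝓥 b p {u | WordLT u (a ++ x :: y :: z :: c)} with hQ
  have hshort : ∀ u v, a ++ u :: v :: c ∈ {u | WordLT u (a ++ x :: y :: z :: c)} := fun u v =>
    wordLT_iff.mpr (Or.inl (by simp))
  have low : word b a * (- relator 𝓥 (p x + p y) (p z) (bracket 𝓥 (b x) (b y)) (b z)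
      + relator 𝓥 (p x) (p y + p z) (b x) (bracket 𝓥 (b y) (b z))
      - koszulSign k (p x) (p y) •
        relator 𝓥 (p y) (p x + p z) (b y) (bracket 𝓥 (b x) (b z))) * word b c ∈ Q := by
    have h1 := homogeneous_relator_mem hb hshort
      (bracket_mem (hb x) (hb y)) (hb z)
    have h2 := homogeneous_relator_mem hb hshort
      (hb x) (bracket_mem (hb y) (hb z))
    have h3 := homogeneous_relator_mem hb hshort
      (hb y) (bracket_mem (hb x) (hb z))
    have h4 := sub_mem (sub_mem h2 h1) (Q.smul_mem (koszulSign k (p x) (p y)) h3)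
    convert h4 using 1
    simp only [mul_sub, sub_mul, mul_add, add_mul, mul_neg, neg_mul, mul_smul_comm, smul_mul_assoc]
    abel
  have main := congrArg (fun t => word b a * t * word b c)
    (relator_overlap (l := p z) (w := b z) (hb x) (hb y))
  -- The two relators in question and the four equally long ones of the overlap identity.
  have A1 : Descent.rel 𝓥 b p ⟨a, x, y, z :: c, hxy⟩ = (if y < x then (1 : k) else 2⁻¹) •
      (word b a * (relator 𝓥 (p x) (p y) (b x) (b y) * TensorAlgebra.ι k (b z)) * word b c) := by
    simp [Descent.rel, mul_assoc]
  have A2 : Descent.rel 𝓥 b p ⟨a ++ [x], y, z, c, hyz⟩ = (if z < y then (1 : k) else 2⁻¹) •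
      (word b a * (TensorAlgebra.ι k (b x) * relator 𝓥 (p y) (p z) (b y) (b z)) * word b c) := by
    simp [Descent.rel, mul_assoc]
  rw [A1, A2]
  have left_mem : ∀ t u v : X, WordLT (a ++ t :: u :: v :: c) (a ++ x :: y :: z :: c) →
      WordLT (a ++ t :: v :: u :: c) (a ++ x :: y :: z :: c) →
      word b a * (TensorAlgebra.ι k (b t) * relator 𝓥 (p u) (p v) (b u) (b v)) * word b c ∈ Q := by
    intro t u v h1 h2
    have := mem_relatorsIn hb (S := {u | WordLT u (a ++ x :: y :: z :: c)}) (a := a ++ [t]) (c := c)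
      (x := u) (y := v) (by simpa using h1) (by simpa using h2)
    simpa [mul_assoc] using this
  have right_mem : ∀ t u v : X, WordLT (a ++ u :: v :: t :: c) (a ++ x :: y :: z :: c) →
      WordLT (a ++ v :: u :: t :: c) (a ++ x :: y :: z :: c) →
      word b a * (relator 𝓥 (p u) (p v) (b u) (b v) * TensorAlgebra.ι k (b t)) * word b c ∈ Q := by
    intro t u v h1 h2
    have := mem_relatorsIn hb (S := {u | WordLT u (a ++ x :: y :: z :: c)}) (a := a)
      (c := t :: c) h1 h2
    simpa [mul_assoc] using this
  have swap2 : ∀ {t u v : X}, v < u →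
      inversions (a ++ t :: v :: u :: c) + 1 = inversions (a ++ t :: u :: v :: c) := by
    intro t u v h
    simpa using inversions_swap (a ++ [t]) h c
  simp only [wordLT_iff, List.length_append, List.length_cons, lt_irrefl, false_or, true_and]
    at left_mem right_mem
  rcases hxy with hxy | ⟨rfl, hx⟩ <;> rcases hyz with hyz | ⟨rfl, hy⟩
  · have s1 := inversions_swap a hxy (z :: c)
    have s2 := inversions_swap a hyz (x :: c)
    have s3 := inversions_swap a (hyz.trans hxy) (y :: c)
    have s4 := swap2 (t := x) hyz
    have s5 := swap2 (t := y) (hyz.trans hxy)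
    have s6 := swap2 (t := z) hxy
    have R1 := left_mem y x z (by omega) (by omega)
    have R2 := right_mem x y z (by omega) (by omega)
    have R3 := right_mem y x z (by omega) (by omega)
    have R4 := left_mem z x y (by omega) (by omega)
    rw [if_pos hxy, if_pos hyz]
    convert add_mem (add_mem (add_mem (add_mem (Q.smul_mem (-koszulSign k (p x) (p y)) R1)
      (Q.smul_mem (-(koszulSign k (p x) (p y) * koszulSign k (p x) (p z))) R2))
      (Q.smul_mem (koszulSign k (p y) (p z)) R3))
      (Q.smul_mem (koszulSign k (p y) (p z) * koszulSign k (p x) (p z)) R4)) low using 1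
    simp only [mul_sub, sub_mul, mul_add, add_mul, mul_neg, neg_mul, mul_smul_comm,
      smul_mul_assoc, mul_assoc] at main ⊢
    linear_combination (norm := module) main
  · have s1 := inversions_swap a hxy (y :: c)
    have s2 := swap2 (t := y) hxy
    have R1 := left_mem y x y (by omega) (by omega)
    have R2 := right_mem x y y (by omega) (by omega)
    rw [if_pos hxy, if_neg (lt_irrefl y)]
    convert Q.smul_mem (2⁻¹ : k) (add_mem (add_mem (Q.smul_mem (-2 * koszulSign k (p x) (p y)) R1)
      (Q.smul_mem (-1 : k) R2)) low) using 1
    have hε := koszulSign_mul_self (k := k) (p x) (p y)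
    rw [hε] at main
    rw [hy, koszulSign_one_one, ← hy] at main
    simp only [mul_sub, sub_mul, mul_add, add_mul, mul_neg, neg_mul, mul_smul_comm,
      smul_mul_assoc, mul_assoc] at main ⊢
    linear_combination (norm := module) (2⁻¹ : k) • main
  · have s1 := inversions_swap a hyz (x :: c)
    have s4 := swap2 (t := x) hyz
    have R3 := right_mem x x z (by omega) (by omega)
    have R4 := left_mem z x x (by omega) (by omega)
    rw [if_neg (lt_irrefl x), if_pos hyz]
    convert Q.smul_mem (2⁻¹ : k) (add_mem (add_mem (Q.smul_mem (2 * koszulSign k (p x) (p z)) R3)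
      R4) low) using 1
    have hε := koszulSign_mul_self (k := k) (p x) (p z)
    rw [hε] at main
    rw [hx, koszulSign_one_one, ← hx] at main
    rw [hx, koszulSign_one_one, ← hx]
    simp only [mul_sub, sub_mul, mul_add, add_mul, mul_neg, neg_mul, mul_smul_comm,
      smul_mul_assoc, mul_assoc] at main ⊢
    linear_combination (norm := module) (2⁻¹ : k) • main
  · -- Three equal odd letters: after moving all terms to one side, the difference in question
    -- occurs three times in the overlap identity, and the relators carry a factor `2⁻¹`.
    rw [if_neg (lt_irrefl x)]
    convert Q.smul_mem (6⁻¹ : k) low using 1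
    rw [hx, koszulSign_one_one, ← hx] at main
    rw [hx, koszulSign_one_one, ← hx]
    simp only [mul_sub, sub_mul, mul_add, add_mul, mul_neg, neg_mul, mul_smul_comm,
      smul_mul_assoc, mul_assoc] at main ⊢
    linear_combination (norm := module) (6⁻¹ : k) • main

/-- Confluence: two relators with the same leading word differ by relators with smaller leading
words. -/
theorem rel_sub_rel_mem (s t : Descent p) (h : s.lead = t.lead) :
    Descent.rel 𝓥 b p s - Descent.rel 𝓥 b p t ∈ relatorsIn 𝓥 b p {u | WordLT u s.lead} := by
  wlog hlen : s.a.length ≤ t.a.length generalizing s t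
  · have := neg_mem (this t s h.symm (by omega))
    rwa [neg_sub, ← h] at this
  obtain ⟨a, x, y, c, hs⟩ := s
  obtain ⟨a', x', y', c', ht⟩ := t
  simp only [Descent.lead] at h hlen ⊢
  obtain ⟨d, rfl⟩ : ∃ d, a' = a ++ d :=
    ⟨a'.drop a.length, by
      have := congrArg (List.take a.length) h
      rw [List.take_left, List.take_append_of_le_length hlen] at this
      conv_lhs => rw [← List.take_append_drop a.length a']
      rw [← this]⟩
  rw [List.append_assoc, List.append_cancel_left_eq] at h
  rcases d with _ | ⟨u, _ | ⟨v, d⟩⟩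
  · simp only [List.nil_append, List.cons.injEq] at h
    obtain ⟨rfl, rfl, rfl⟩ := h
    simp
  · simp only [List.cons_append, List.nil_append, List.cons.injEq] at h
    obtain ⟨rfl, rfl, rfl⟩ := h
    exact overlap_mem_relatorsIn hb a c' hs ht
  · simp only [List.cons_append, List.cons.injEq] at h
    obtain ⟨rfl, rfl, rfl⟩ := h
    exact disjoint_mem_relatorsIn a d c' hs ht

end Confluence

end LieSuperalgebra
end

noncomputable section

namespace LieSuperalgebra

/-! ### The Poincaré–Birkhoff–Witt theorem for Lie superalgebras -/

section NormalWord

variable {X : Type*} [LinearOrder X] (p : X → ZMod 2)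

/-- Normal words: weakly increasing words without repeated odd letters. -/
def IsNormalWord (l : List X) : Prop := l.Pairwise fun x y => x < y ∨ x = y ∧ p x = 0

variable {p}

theorem not_isDescent_iff {x y : X} : ¬ IsDescent p x y ↔ x < y ∨ x = y ∧ p x = 0 := by
  have hp : ¬ p x = 1 ↔ p x = 0 := by
    generalize p x = q
    revert q
    decide
  unfold IsDescent
  rcases lt_trichotomy x y with h | h | h
  · simp [h, h.ne, h.le]
  · subst h
    simpa using hp
  · simp [h, h.ne', h.le]

theorem isNormalWord_of_forall_lead_ne {w : List X} (h : ∀ s : Descent p, s.lead ≠ w) :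
    IsNormalWord p w := by
  have : IsTrans X fun x y => x < y ∨ x = y ∧ p x = 0 :=
    ⟨by
      rintro x y z (h | ⟨rfl, h⟩) (h' | ⟨rfl, h'⟩)
      · exact Or.inl (h.trans h')
      · exact Or.inl h
      · exact Or.inl h'
      · exact Or.inr ⟨rfl, h⟩⟩
  unfold IsNormalWord
  rw [← List.isChain_iff_pairwise, List.isChain_iff_forall_rel_of_append_cons_cons]
  intro x y a c hw
  by_contra hxy
  rw [← not_isDescent_iff, not_not] at hxy
  exact h ⟨a, x, y, c, hxy⟩ hw.symm

theorem IsNormalWord.lead_ne {w : List X} (h : IsNormalWord p w) (s : Descent p) : s.lead ≠ w := by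
  rintro rfl
  have h1 := List.pairwise_append.mp h
  have h2 := (List.pairwise_cons.mp h1.2.1).1 s.y (by simp)
  exact not_isDescent_iff.mpr h2 s.isDescent

end NormalWord

section PBW

variable {k V X : Type*} [Field k] [CharZero k] [AddCommGroup V] [Module k V]
  (𝓥 : ZMod 2 → Submodule k V) [LieSuperalgebra 𝓥] (b : Module.Basis X k V)

/-- The canonical map from the tensor algebra to the enveloping superalgebra. -/
def toEnveloping : TensorAlgebra k V →ₐ[k] Enveloping 𝓥 := TensorAlgebra.lift k (Enveloping.ι 𝓥)

theorem toEnveloping_ι (v : V) :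
    toEnveloping 𝓥 (TensorAlgebra.ι k v) = Enveloping.ι 𝓥 v := by
  simp [toEnveloping]

theorem toEnveloping_surjective : Function.Surjective (toEnveloping 𝓥) := by
  have h : toEnveloping 𝓥 = RingQuot.mkAlgHom k (EnvelopingRel 𝓥) := by
    refine TensorAlgebra.hom_ext ?_
    ext v
    exact toEnveloping_ι 𝓥 v
  rw [h]
  exact RingQuot.mkAlgHom_surjective k _

theorem toEnveloping_relator {i j : ZMod 2} {v w : V} (hv : v ∈ 𝓥 i) (hw : w ∈ 𝓥 j) :
    toEnveloping 𝓥 (relator 𝓥 i j v w) = 0 := by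
  unfold relator
  rw [map_sub, map_sub, map_smul, map_mul, map_mul]
  simp only [toEnveloping_ι]
  rw [Enveloping.ι_bracket 𝓥 hv hw, sub_self]

/-- The product in the enveloping superalgebra of the basis vectors named by the letters of a
word. -/
def envWord (l : List X) : Enveloping 𝓥 := (l.map fun x => Enveloping.ι 𝓥 (b x)).prod

@[simp]
theorem envWord_nil : envWord 𝓥 b [] = 1 := rfl

@[simp]
theorem envWord_cons (x : X) (l : List X) :
    envWord 𝓥 b (x :: l) = Enveloping.ι 𝓥 (b x) * envWord 𝓥 b l := by
  simp [envWord]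

@[simp]
theorem envWord_append (l m : List X) :
    envWord 𝓥 b (l ++ m) = envWord 𝓥 b l * envWord 𝓥 b m := by
  simp [envWord]

theorem toEnveloping_word (l : List X) : toEnveloping 𝓥 (word b l) = envWord 𝓥 b l := by
  induction l with
  | nil => simp
  | cons x l ih => rw [word_cons, map_mul, ih, toEnveloping_ι, envWord_cons]

theorem mem_span_envWord (u : Enveloping 𝓥) :
    u ∈ Submodule.span k (Set.range (envWord 𝓥 b)) := by
  obtain ⟨f, rfl⟩ := toEnveloping_surjective 𝓥 u
  have h7 := Submodule.mem_map_of_mem (f := (toEnveloping 𝓥).toLinearMap) ((wordBasis b).mem_span f)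
  rw [Submodule.map_span, ← Set.range_comp] at h7
  have h8 : (toEnveloping 𝓥).toLinearMap ∘ wordBasis b = envWord 𝓥 b :=
    funext fun l => by
      rw [Function.comp_apply, wordBasis_apply]
      exact toEnveloping_word 𝓥 b l
  rw [h8] at h7
  exact h7

variable [LinearOrder X] (p : X → ZMod 2)

theorem exists_wordNormalForm (hb : ∀ x, b x ∈ 𝓥 (p x)) :
    ∃ N : TensorAlgebra k V →ₗ[k] TensorAlgebra k V,
      (∀ f ∈ relatorsIn 𝓥 b p Set.univ, N f = 0) ∧
      (∀ w, IsNormalWord p w → N (word b w) = word b w) ∧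
      (∀ f, f - N f ∈ relatorsIn 𝓥 b p Set.univ) ∧
      ∀ w, N (word b w) ∈
        Submodule.span k (word b '' {w' | w'.length ≤ w.length ∧ IsNormalWord p w'}) := by
  have hword : ⇑(wordBasis b) = word b := funext (wordBasis_apply b)
  obtain ⟨N, h1, h2, h3, h4⟩ := exists_normalForm (wordBasis b) WordLT wordLT_wf
    (Descent.lead (p := p)) (Descent.rel 𝓥 b p)
    (by rw [hword]; exact word_lead_sub_rel_mem) (fun s t h => rel_sub_rel_mem hb s t h)
  rw [hword] at h2 h4
  have hrel : relatorsIn 𝓥 b p Set.univ = Submodule.span k (Set.range (Descent.rel 𝓥 b p)) := by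
    simp [relatorsIn]
  rw [hrel]
  refine ⟨N, fun f hf => ?_, fun w hw => h2 w fun s => hw.lead_ne s, h3, fun w => ?_⟩
  · have : Submodule.span k (Set.range (Descent.rel 𝓥 b p)) ≤ LinearMap.ker N := by
      rw [Submodule.span_le]
      rintro _ ⟨s, rfl⟩
      exact h1 s
    exact this hf
  · have h5 := h4 {w' | w'.length ≤ w.length} (fun s hs => by
      refine Submodule.span_mono (Set.image_mono fun w' hw' => ?_) (word_lead_sub_rel_mem s)
      have h6 : s.lead.length ≤ w.length := hs
      rcases wordLT_iff.mp hw' with h | h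
      · exact h.le.trans h6
      · exact h.1.le.trans h6) (word b w) (Submodule.subset_span ⟨w, le_refl w.length, rfl⟩)
    have h6 : {w' ∈ {w' : List X | w'.length ≤ w.length} | ∀ s : Descent p, s.lead ≠ w'} ⊆
        {w' | w'.length ≤ w.length ∧ IsNormalWord p w'} :=
      fun w' hw' => ⟨hw'.1, isNormalWord_of_forall_lead_ne hw'.2⟩
    exact Submodule.span_mono (Set.image_mono h6) h5

variable {p} in
/-- The Poincaré–Birkhoff–Witt theorem for Lie superalgebras: a linear map on the enveloping
superalgebra that reads off the coordinates with respect to the normal words. Its second property,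
combined with the spanning property below, says that the normal words form a basis, compatible with
the filtration by length. -/
theorem exists_normalCoord (hb : ∀ x, b x ∈ 𝓥 (p x)) :
    ∃ κ : Enveloping 𝓥 →ₗ[k] List X →₀ k,
      (∀ w, IsNormalWord p w → κ (envWord 𝓥 b w) = Finsupp.single w 1) ∧
      ∀ w, κ (envWord 𝓥 b w) ∈
        Finsupp.supported k k {w' | w'.length ≤ w.length ∧ IsNormalWord p w'} := by
  obtain ⟨N, h1, h2, h3, h4⟩ := exists_wordNormalForm 𝓥 b p hb
  -- The relators span a left ideal, so that multiplication followed by `N` is a representation.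
  have hleft : ∀ (v : V), ∀ f ∈ relatorsIn 𝓥 b p Set.univ,
      TensorAlgebra.ι k v * f ∈ relatorsIn 𝓥 b p Set.univ := by
    intro v f hf
    have hv := b.mem_span v
    induction hv using Submodule.span_induction with
    | zero => simp
    | add v w _ _ hv hw =>
      rw [map_add, add_mul]
      exact add_mem hv hw
    | smul r v _ hv =>
      rw [map_smul, smul_mul_assoc]
      exact Submodule.smul_mem _ r hv
    | mem v hv =>
      obtain ⟨x, rfl⟩ := hv
      induction hf using Submodule.span_induction with
      | zero => simp
      | add f g _ _ hf hg =>
        rw [mul_add]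
        exact add_mem hf hg
      | smul r f _ hf =>
        rw [mul_smul_comm]
        exact Submodule.smul_mem _ r hf
      | mem f hf =>
        obtain ⟨s, -, rfl⟩ := hf
        refine Submodule.subset_span ⟨⟨x :: s.a, s.x, s.y, s.c, s.isDescent⟩, trivial, ?_⟩
        simp [Descent.rel, mul_assoc]
  have hN : ∀ v f, N (TensorAlgebra.ι k v * N f) = N (TensorAlgebra.ι k v * f) := fun v f => by
    have := h1 _ (hleft v _ (h3 f))
    rw [mul_sub, map_sub, sub_eq_zero] at this
    exact this.symm
  have hrel : ∀ {i j : ZMod 2} {v w : V}, v ∈ 𝓥 i → w ∈ 𝓥 j → ∀ f,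
      N (relator 𝓥 i j v w * f) = 0 := by
    intro i j v w hv hw f
    have hf := (wordBasis b).mem_span f
    induction hf using Submodule.span_induction with
    | zero => simp
    | add f g _ _ hf hg => rw [mul_add, map_add, hf, hg, add_zero]
    | smul r f _ hf => rw [mul_smul_comm, map_smul, hf, smul_zero]
    | mem f hf =>
      obtain ⟨c, rfl⟩ := hf
      rw [wordBasis_apply]
      have := homogeneous_relator_mem hb (S := Set.univ) (a := []) (c := c)
        (fun _ _ => trivial) hv hw
      rw [word_nil, one_mul] at this
      exact h1 _ this
  let ρ : V →ₗ[k] Module.End k (TensorAlgebra k V) :=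
    (LinearMap.llcomp k _ _ _ N) ∘ₗ (LinearMap.mul k (TensorAlgebra k V)) ∘ₗ TensorAlgebra.ι k
  have hρ : ∀ v f, ρ v f = N (TensorAlgebra.ι k v * f) := fun v f => rfl
  let Φ := Enveloping.lift 𝓥 ρ (by
    intro i j v w hv hw
    ext1 f
    rw [LinearMap.sub_apply, LinearMap.smul_apply, Module.End.mul_apply, Module.End.mul_apply]
    rw [hρ, hρ, hρ, hρ, hρ, hN, hN]
    have := hrel hv hw f
    rw [relator, sub_mul, sub_mul, map_sub, map_sub, smul_mul_assoc, map_smul, mul_assoc,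
      mul_assoc] at this
    exact sub_eq_zero.mp this)
  have hΦ : ∀ w, Φ (envWord 𝓥 b w) 1 = N (word b w) := fun w => by
    induction w with
    | nil =>
      rw [envWord_nil, map_one Φ, Module.End.one_apply]
      exact (h2 [] List.Pairwise.nil).symm
    | cons x w ih =>
      rw [envWord_cons, map_mul, Module.End.mul_apply, ih, Enveloping.lift_ι, hρ, hN, word_cons]
  refine ⟨(wordBasis b).repr.toLinearMap ∘ₗ LinearMap.applyₗ 1 ∘ₗ Φ.toLinearMap,
    fun w hw => ?_, fun w => ?_⟩
  · have : Φ (envWord 𝓥 b w) 1 = wordBasis b w := by rw [hΦ, h2 w hw, wordBasis_apply]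
    simp [this]
  · have h5 := h4 w
    rw [← hΦ, ← funext (wordBasis_apply b), Module.Basis.mem_span_image] at h5
    exact h5

variable {p} in
theorem envWord_mem_span_normal (hb : ∀ x, b x ∈ 𝓥 (p x)) (w : List X) :
    envWord 𝓥 b w ∈
      Submodule.span k (envWord 𝓥 b '' {w' | w'.length ≤ w.length ∧ IsNormalWord p w'}) := by
  obtain ⟨N, -, -, h3, h4⟩ := exists_wordNormalForm 𝓥 b p hb
  have h5 : relatorsIn 𝓥 b p Set.univ ≤ LinearMap.ker (toEnveloping 𝓥).toLinearMap := by
    unfold relatorsIn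
    rw [Submodule.span_le]
    rintro _ ⟨s, -, rfl⟩
    have : toEnveloping 𝓥 (s.rel 𝓥 b p) = 0 := by
      rw [Descent.rel, map_mul, map_mul, map_smul, toEnveloping_relator 𝓥 (hb _) (hb _)]
      simp
    exact this
  have h6 : toEnveloping 𝓥 (word b w - N (word b w)) = 0 := h5 (h3 (word b w))
  rw [map_sub, sub_eq_zero, toEnveloping_word] at h6
  have h7 := Submodule.mem_map_of_mem (f := (toEnveloping 𝓥).toLinearMap) (h4 w)
  rw [Submodule.map_span, ← Set.image_comp] at h7
  have h8 : (toEnveloping 𝓥).toLinearMap ∘ word b = envWord 𝓥 b :=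
    funext (toEnveloping_word 𝓥 b)
  rw [h8] at h7
  rw [h6]
  exact h7

end PBW

end LieSuperalgebra
end

noncomputable section

/-! ### Supercommutators -/

section SuperCommutator

variable {k A : Type*} [CommRing k] [Ring A] [Algebra k A]
  (𝒜 : ZMod 2 → Submodule k A) [GradedAlgebra 𝒜]

theorem superCommutator_add_left (z w u : A) :
    superCommutator 𝒜 (z + w) u = superCommutator 𝒜 z u + superCommutator 𝒜 w u := by
  unfold superCommutator
  simp only [← Finset.sum_add_distrib]
  refine Finset.sum_congr rfl fun i _ => Finset.sum_congr rfl fun j _ => ?_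
  rw [DirectSum.decompose_add, DirectSum.add_apply, Submodule.coe_add, add_mul, mul_add, smul_add]
  abel

theorem superCommutator_smul_left (r : k) (z u : A) :
    superCommutator 𝒜 (r • z) u = r • superCommutator 𝒜 z u := by
  unfold superCommutator
  simp only [Finset.smul_sum]
  refine Finset.sum_congr rfl fun i _ => Finset.sum_congr rfl fun j _ => ?_
  rw [DirectSum.decompose_smul, DirectSum.smul_apply, Submodule.coe_smul, smul_mul_assoc,
    mul_smul_comm, smul_sub, smul_comm r]

theorem superCommutator_add_right (z u v : A) :
    superCommutator 𝒜 z (u + v) = superCommutator 𝒜 z u + superCommutator 𝒜 z v := by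
  unfold superCommutator
  simp only [← Finset.sum_add_distrib]
  refine Finset.sum_congr rfl fun i _ => Finset.sum_congr rfl fun j _ => ?_
  rw [DirectSum.decompose_add, DirectSum.add_apply, Submodule.coe_add, add_mul, mul_add, smul_add]
  abel

theorem superCommutator_sum_right {S : Type*} (s : Finset S) (z : A) (f : S → A) :
    superCommutator 𝒜 z (∑ i ∈ s, f i) = ∑ i ∈ s, superCommutator 𝒜 z (f i) :=
  map_sum (AddMonoidHom.mk' (superCommutator 𝒜 z) (superCommutator_add_right 𝒜 z)) f s

theorem superCommutator_linearCombination {W : Type*} (f : W →₀ k) (g : W → A) (u : A) :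
    superCommutator 𝒜 (Finsupp.linearCombination k g f) u =
      f.sum fun w c => c • superCommutator 𝒜 (g w) u := by
  let T : A →ₗ[k] A :=
    { toFun := fun z => superCommutator 𝒜 z u
      map_add' := fun z w => superCommutator_add_left 𝒜 z w u
      map_smul' := fun r z => superCommutator_smul_left 𝒜 r z u }
  have := Finsupp.apply_linearCombination k T g f
  rw [Finsupp.linearCombination_apply] at this
  exact this

end SuperCommutator

namespace LieSuperalgebra

/-! ### Central elements of a Lie superalgebra -/

section Center

variable {k V : Type*} [Field k] [CharZero k] [AddCommGroup V] [Module k V]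
  {𝓥 : ZMod 2 → Submodule k V} [LieSuperalgebra 𝓥]

theorem mem_center_iff {c : V} : c ∈ center 𝓥 ↔ ∀ v, bracket 𝓥 c v = 0 := by
  rw [center, LinearMap.mem_ker, LinearMap.ext_iff]
  rfl

theorem mem_center_of_homogeneous {c : V} (h : ∀ j, ∀ v ∈ 𝓥 j, bracket 𝓥 c v = 0) :
    c ∈ center 𝓥 := by
  rw [mem_center_iff]
  intro v
  induction v using DirectSum.Decomposition.inductionOn 𝓥 with
  | zero => simp
  | homogeneous m => exact h _ _ m.2
  | add v w hv hw => rw [map_add, hv, hw, add_zero]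

theorem sum_decompose_eq (c : V) : ∑ a : ZMod 2, (DirectSum.decompose 𝓥 c a : V) = c := by
  classical
  conv_rhs => rw [← DirectSum.sum_support_decompose 𝓥 c]
  refine (Finset.sum_subset (Finset.subset_univ _) fun a _ ha => ?_).symm
  simpa using ha

/-- The center is a graded subspace. -/
theorem decompose_mem_center {c : V} (hc : c ∈ center 𝓥) (i : ZMod 2) :
    (DirectSum.decompose 𝓥 c i : V) ∈ center 𝓥 := by
  refine mem_center_of_homogeneous fun j v hv => ?_
  have h1 : ∑ a : ZMod 2, bracket 𝓥 (DirectSum.decompose 𝓥 c a : V) v = 0 := by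
    rw [← LinearMap.sum_apply, ← map_sum, sum_decompose_eq]
    exact mem_center_iff.mp hc v
  have hmem : ∀ a, bracket 𝓥 (DirectSum.decompose 𝓥 c a : V) v ∈ 𝓥 (a + j) := fun a =>
    bracket_mem (SetLike.coe_mem _) hv
  have h3 := congrArg (fun t => (DirectSum.decompose 𝓥 t (i + j) : V)) h1
  simp only [DirectSum.decompose_sum, DirectSum.decompose_zero, DirectSum.zero_apply,
    ZeroMemClass.coe_zero] at h3
  rwa [DirectSum.sum_apply, AddSubmonoidClass.coe_finsetSum, Finset.sum_eq_single i,
    DirectSum.decompose_of_mem_same 𝓥 (hmem i)] at h3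
  · intro a _ ha
    exact DirectSum.decompose_of_mem_ne 𝓥 (hmem a) fun e => ha (add_right_cancel e)
  · simp

theorem superCommutator_ι_eq_zero_of_homogeneous {i : ZMod 2} {c : V} (hc : c ∈ center 𝓥)
    (hi : c ∈ 𝓥 i) (u : Enveloping 𝓥) :
    superCommutator (Enveloping.grading 𝓥) (Enveloping.ι 𝓥 c) u = 0 := by
  have key : ∀ l : List (Σ j : ZMod 2, 𝓥 j),
      Enveloping.ι 𝓥 c * (l.map fun x => Enveloping.ι 𝓥 (x.2 : V)).prod =
        koszulSign k i (l.map Sigma.fst).sum •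
          ((l.map fun x => Enveloping.ι 𝓥 (x.2 : V)).prod * Enveloping.ι 𝓥 c) := by
    intro l
    induction l with
    | nil => simp [koszulSign]
    | cons x l ih =>
      have h := Enveloping.ι_bracket 𝓥 hi x.2.2
      rw [mem_center_iff.mp hc, map_zero, sub_eq_zero] at h
      simp only [List.map_cons, List.prod_cons, List.sum_cons]
      rw [← mul_assoc, h, smul_mul_assoc, mul_assoc, ih, mul_smul_comm, smul_smul, ← mul_assoc,
        koszulSign_add_right]
  have hhom : ∀ j, ∀ v ∈ Enveloping.grading 𝓥 j,
      superCommutator (Enveloping.grading 𝓥) (Enveloping.ι 𝓥 c) v = 0 := by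
    intro j v hv
    rw [superCommutator_of_mem _ (Enveloping.ι_mem_grading 𝓥 hi) hv, sub_eq_zero]
    induction hv using Submodule.span_induction with
    | zero => simp
    | add v w _ _ hv hw => rw [mul_add, add_mul, smul_add, hv, hw]
    | smul r v _ hv => rw [mul_smul_comm, smul_mul_assoc, hv, smul_comm r]
    | mem v hv =>
      obtain ⟨l, rfl, rfl⟩ := hv
      exact key l
  rw [← sum_univ_decompose (Enveloping.grading 𝓥) u, superCommutator_sum_right]
  exact Finset.sum_eq_zero fun j _ => hhom j _ (SetLike.coe_mem _)

theorem ι_mem_superCenter {c : V} (hc : c ∈ center 𝓥) :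
    Enveloping.ι 𝓥 c ∈ superCenter (Enveloping.grading 𝓥) := by
  rw [← sum_decompose_eq (𝓥 := 𝓥) c, map_sum]
  exact sum_mem fun i _ =>
    superCommutator_ι_eq_zero_of_homogeneous (decompose_mem_center hc i) (SetLike.coe_mem _)

end Center

/-! ### Supercommutators with elements of the Lie superalgebra, up to shorter words -/

section Leading

variable {k X : Type*} [Field k] (p : X → ZMod 2)

variable (k) in
/-- The formal sum of the pairs `(m, x)` obtained from a word by removing one letter `x`, leaving
the word `m`, with the sign that results from moving the letter to the end of the word. This is
the symbol of the derivation which a supercommutator induces on leading terms. -/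
def removeLetter : List X → (List X × X →₀ k)
  | [] => 0
  | x :: l => Finsupp.single (l, x) (koszulSign k (p x) (l.map p).sum) +
      (removeLetter l).mapDomain fun m => (x :: m.1, m.2)

variable {p} in
theorem perm_of_removeLetter_ne_zero {l m : List X} {x : X}
    (h : removeLetter k p l (m, x) ≠ 0) : l.Perm (x :: m) := by
  classical
  induction l generalizing m with
  | nil => simp [removeLetter] at h
  | cons y l ih =>
    rw [removeLetter, Finsupp.add_apply] at h
    by_cases h1 : (l, y) = (m, x)
    · obtain ⟨rfl, rfl⟩ := Prod.mk.inj h1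
      exact List.Perm.refl _
    · rw [Finsupp.single_eq_of_ne (Ne.symm h1), zero_add] at h
      have h2 := Finsupp.mapDomain_support (Finsupp.mem_support_iff.mpr h)
      obtain ⟨⟨m', x'⟩, hm', he⟩ := Finset.mem_image.mp h2
      obtain ⟨rfl, rfl⟩ := Prod.mk.inj he
      exact ((ih (Finsupp.mem_support_iff.mp hm')).cons y).trans (List.Perm.swap _ _ _)

theorem removeLetter_cons_cons (y : X) (l m : List X) (x : X) :
    removeLetter k p (y :: l) (y :: m, x) =
      Finsupp.single (l, y) (koszulSign k (p y) (l.map p).sum) (y :: m, x) +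
        removeLetter k p l (m, x) := by
  rw [removeLetter, Finsupp.add_apply]
  congr 1
  have hinj : Function.Injective fun m : List X × X => (y :: m.1, m.2) := by
    rintro ⟨a, b⟩ ⟨c, d⟩ h
    simpa using h
  exact Finsupp.mapDomain_apply hinj _ (m, x)

theorem removeLetter_cons_apply_of_head_ne {y : X} {l m : List X} {x : X}
    (h : ∀ m', m ≠ y :: m') : removeLetter k p (y :: l) (m, x) =
      Finsupp.single (l, y) (koszulSign k (p y) (l.map p).sum) (m, x) := by
  rw [removeLetter, Finsupp.add_apply, Finsupp.mapDomain_of_notMem_range, add_zero]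
  rintro ⟨m', he⟩
  exact h m'.1 (Prod.mk.inj he).1.symm

variable [CharZero k] [LinearOrder X]

variable {p} in
/-- In a normal word, removing an even letter in all possible ways gives the same word each time,
always with sign `1`. -/
theorem removeLetter_erase_of_even {l : List X} (hl : IsNormalWord p l) {x : X} (hx : p x = 0) :
    removeLetter k p l (l.erase x, x) = l.count x := by
  induction l with
  | nil => simp [removeLetter]
  | cons y l ih =>
    have hl' := List.pairwise_cons.mp hl
    by_cases hxy : y = x
    · subst hxy
      rw [List.erase_cons_head, List.count_cons_self]
      rcases l with _ | ⟨z, l⟩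
      · rw [removeLetter_cons_apply_of_head_ne p (by simp), Finsupp.single_eq_same, hx,
          koszulSign_zero_left]
        simp
      · by_cases hz : z = y
        · subst hz
          rw [removeLetter_cons_cons, Finsupp.single_eq_same, hx, koszulSign_zero_left]
          have := ih hl'.2
          rw [List.erase_cons_head] at this
          rw [this]
          push_cast
          ring
        · have h0 : (z :: l).count y = 0 := by
            rw [List.count_eq_zero]
            intro hy
            have h1 : y < z := by
              rcases hl'.1 z (by simp) with h | h
              · exact h
              · exact absurd h.1.symm hz
            rcases List.mem_cons.mp hy with h | h
            · exact hz h.symm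
            · rcases (List.pairwise_cons.mp hl'.2).1 y h with h2 | h2
              · exact absurd (h1.trans h2) (lt_irrefl _)
              · exact hz h2.1
          rw [removeLetter_cons_apply_of_head_ne p (by simpa using hz), Finsupp.single_eq_same, hx,
            koszulSign_zero_left, h0]
          simp
    · rw [List.erase_cons_tail (by simpa using hxy), removeLetter_cons_cons,
        Finsupp.single_eq_of_ne (by simp [Ne.symm hxy]), zero_add, ih hl'.2,
        List.count_cons_of_ne hxy]

variable {p} in
theorem removeLetter_erase_ne_zero {l : List X} (hl : IsNormalWord p l) {x : X} (hx : x ∈ l) :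
    removeLetter k p l (l.erase x, x) ≠ 0 := by
  by_cases hp : p x = 0
  · rw [removeLetter_erase_of_even hl hp]
    have : l.count x ≠ 0 := (List.count_pos_iff.mpr hx).ne'
    exact_mod_cast this
  · induction l with
    | nil => simp at hx
    | cons y l ih =>
      have hl' := List.pairwise_cons.mp hl
      by_cases hxy : y = x
      · subst hxy
        rw [List.erase_cons_head, removeLetter_cons_apply_of_head_ne, Finsupp.single_eq_same]
        · rcases koszulSign_eq_or (k := k) (p y) (l.map p).sum with h | h <;> rw [h] <;> simp
        · rintro m' rfl
          rcases hl'.1 y (by simp) with h | h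
          · exact lt_irrefl _ h
          · exact hp h.2
      · have hx' : x ∈ l := (List.mem_cons.mp hx).resolve_left (Ne.symm hxy)
        rw [List.erase_cons_tail (by simpa using hxy), removeLetter_cons_cons,
          Finsupp.single_eq_of_ne (by simp [Ne.symm hxy]), zero_add]
        exact ih hl'.2 hx'

end Leading

section Commutator

variable {k V X : Type*} [Field k] [CharZero k] [AddCommGroup V] [Module k V]
  (𝓥 : ZMod 2 → Submodule k V) [LieSuperalgebra 𝓥] (b : Module.Basis X k V)

/-- The span of the products of fewer than `n` elements. -/
def lengthLT (n : ℕ) : Submodule k (Enveloping 𝓥) :=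
  Submodule.span k (envWord 𝓥 b '' {w | w.length < n})

variable {𝓥 b}

theorem envWord_mem_lengthLT {w : List X} {n : ℕ} (h : w.length < n) :
    envWord 𝓥 b w ∈ lengthLT 𝓥 b n := Submodule.subset_span ⟨w, h, rfl⟩

theorem lengthLT_mono {m n : ℕ} (h : m ≤ n) : lengthLT 𝓥 b m ≤ lengthLT 𝓥 b n :=
  Submodule.span_mono (Set.image_mono fun _ hw => lt_of_lt_of_le hw h)

theorem mul_ι_mul_mem_lengthLT (l m : List X) (v : V) :
    envWord 𝓥 b l * Enveloping.ι 𝓥 v * envWord 𝓥 b m ∈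
      lengthLT 𝓥 b (l.length + m.length + 2) := by
  have hv := b.mem_span v
  induction hv using Submodule.span_induction with
  | zero => simp
  | add v w _ _ hv hw =>
    rw [map_add, mul_add, add_mul]
    exact add_mem hv hw
  | smul r v _ hv =>
    rw [map_smul, mul_smul_comm, smul_mul_assoc]
    exact Submodule.smul_mem _ r hv
  | mem v hv =>
    obtain ⟨x, rfl⟩ := hv
    have : envWord 𝓥 b l * Enveloping.ι 𝓥 (b x) * envWord 𝓥 b m = envWord 𝓥 b (l ++ x :: m) := by
      simp [mul_assoc]
    rw [this]
    exact envWord_mem_lengthLT (by simp; omega)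

theorem ι_mul_mem_lengthLT (x : X) {n : ℕ} {u : Enveloping 𝓥} (hu : u ∈ lengthLT 𝓥 b n) :
    Enveloping.ι 𝓥 (b x) * u ∈ lengthLT 𝓥 b (n + 1) := by
  induction hu using Submodule.span_induction with
  | zero => simp
  | add v w _ _ hv hw =>
    rw [mul_add]
    exact add_mem hv hw
  | smul r v _ hv =>
    rw [mul_smul_comm]
    exact Submodule.smul_mem _ r hv
  | mem v hv =>
    obtain ⟨w, hw, rfl⟩ := hv
    rw [← envWord_cons]
    exact envWord_mem_lengthLT (by simpa using hw)

variable {p : X → ZMod 2} (hb : ∀ x, b x ∈ 𝓥 (p x))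
include hb

theorem envWord_mem_grading (w : List X) :
    envWord 𝓥 b w ∈ Enveloping.grading 𝓥 (w.map p).sum := by
  induction w with
  | nil => exact SetLike.GradedOne.one_mem
  | cons x w ih =>
    rw [envWord_cons, List.map_cons, List.sum_cons]
    exact SetLike.mul_mem_graded (Enveloping.ι_mem_grading 𝓥 (hb x)) ih

theorem superCommutator_envWord (w : List X) {j : ZMod 2} {v : V} (hv : v ∈ 𝓥 j) :
    superCommutator (Enveloping.grading 𝓥) (envWord 𝓥 b w) (Enveloping.ι 𝓥 v) =
      envWord 𝓥 b w * Enveloping.ι 𝓥 v -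
        koszulSign k (w.map p).sum j • (Enveloping.ι 𝓥 v * envWord 𝓥 b w) :=
  superCommutator_of_mem _ (envWord_mem_grading hb w) (Enveloping.ι_mem_grading 𝓥 hv)

/-- The Leibniz rule for supercommutators. -/
theorem superCommutator_envWord_cons (x : X) (w : List X) {j : ZMod 2} {v : V} (hv : v ∈ 𝓥 j) :
    superCommutator (Enveloping.grading 𝓥) (envWord 𝓥 b (x :: w)) (Enveloping.ι 𝓥 v) =
      Enveloping.ι 𝓥 (b x) *
          superCommutator (Enveloping.grading 𝓥) (envWord 𝓥 b w) (Enveloping.ι 𝓥 v) +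
        koszulSign k (w.map p).sum j •
          (Enveloping.ι 𝓥 (bracket 𝓥 (b x) v) * envWord 𝓥 b w) := by
  rw [superCommutator_envWord hb _ hv, superCommutator_envWord hb _ hv,
    ← Enveloping.ι_bracket 𝓥 (hb x) hv, List.map_cons, List.sum_cons, koszulSign_add_left,
    envWord_cons]
  simp only [mul_sub, sub_mul, mul_smul_comm, smul_mul_assoc, mul_assoc]
  module

theorem superCommutator_envWord_mem (w : List X) {j : ZMod 2} {v : V} (hv : v ∈ 𝓥 j) :
    superCommutator (Enveloping.grading 𝓥) (envWord 𝓥 b w) (Enveloping.ι 𝓥 v) ∈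
      lengthLT 𝓥 b (w.length + 1) := by
  induction w with
  | nil =>
    rw [superCommutator_envWord hb _ hv]
    simp [koszulSign]
  | cons x w ih =>
    rw [superCommutator_envWord_cons hb x w hv]
    refine add_mem (ι_mul_mem_lengthLT x ih) (Submodule.smul_mem _ _ ?_)
    have := mul_ι_mul_mem_lengthLT (𝓥 := 𝓥) (b := b) [] w (bracket 𝓥 (b x) v)
    simpa using this

/-- Up to shorter words, the supercommutator of a word with `v` is the sum over the letters `x` of
the word, with the sign of moving `x` to the end, of the products in which `x` is removed and
`[x, v]` is put at the end. -/
theorem superCommutator_envWord_sub_mem (w : List X) {j : ZMod 2} {v : V} (hv : v ∈ 𝓥 j) :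
    superCommutator (Enveloping.grading 𝓥) (envWord 𝓥 b w) (Enveloping.ι 𝓥 v) -
        Finsupp.linearCombination k
          (fun m : List X × X => envWord 𝓥 b m.1 * Enveloping.ι 𝓥 (bracket 𝓥 (b m.2) v))
          (removeLetter k p w) ∈ lengthLT 𝓥 b w.length := by
  induction w with
  | nil =>
    rw [superCommutator_envWord hb _ hv]
    simp [koszulSign, removeLetter]
  | cons x w ih =>
    have h1 := superCommutator_envWord_mem hb w (bracket_mem (hb x) hv)
    rw [superCommutator_envWord_cons hb x w hv]
    rw [superCommutator_envWord hb w (bracket_mem (hb x) hv)] at h1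
    rw [removeLetter, map_add, Finsupp.linearCombination_single, Finsupp.linearCombination_mapDomain]
    have h2 : Finsupp.linearCombination k
        ((fun m : List X × X => envWord 𝓥 b m.1 * Enveloping.ι 𝓥 (bracket 𝓥 (b m.2) v)) ∘
          fun m => (x :: m.1, m.2)) (removeLetter k p w) =
        Enveloping.ι 𝓥 (b x) * Finsupp.linearCombination k
          (fun m : List X × X => envWord 𝓥 b m.1 * Enveloping.ι 𝓥 (bracket 𝓥 (b m.2) v))
          (removeLetter k p w) := by
      simp [Finsupp.linearCombination_apply, Finsupp.mul_sum, mul_assoc]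
    rw [h2]
    rw [List.length_cons]
    convert sub_mem (ι_mul_mem_lengthLT x ih)
      (Submodule.smul_mem _ (koszulSign k (p x) (w.map p).sum) h1) using 1
    rw [koszulSign_add_right, koszulSign_comm _ (p x)]
    simp only [mul_sub, smul_sub, smul_smul]
    rw [← mul_assoc, koszulSign_mul_self]
    module

end Commutator

end LieSuperalgebra
end

noncomputable section

namespace LieSuperalgebra

/-! ### The supercenter of the enveloping superalgebra of a current superalgebra -/

theorem sublist_of_removeLetter_ne_zero {k X : Type*} [Field k] {p : X → ZMod 2} {l m : List X}
    {x : X} (h : removeLetter k p l (m, x) ≠ 0) : m.Sublist l := by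
  classical
  induction l generalizing m with
  | nil => simp [removeLetter] at h
  | cons y l ih =>
    rw [removeLetter, Finsupp.add_apply] at h
    by_cases h1 : (l, y) = (m, x)
    · obtain ⟨rfl, rfl⟩ := Prod.mk.inj h1
      exact List.sublist_cons_self _ _
    · rw [Finsupp.single_eq_of_ne (Ne.symm h1), zero_add] at h
      have h2 := Finsupp.mapDomain_support (Finsupp.mem_support_iff.mpr h)
      obtain ⟨⟨m', x'⟩, hm', he⟩ := Finset.mem_image.mp h2
      obtain ⟨rfl, rfl⟩ := Prod.mk.inj he
      exact (ih (Finsupp.mem_support_iff.mp hm')).cons_cons y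

theorem IsNormalWord.eq_of_perm {X : Type*} [LinearOrder X] {p : X → ZMod 2} {l m : List X}
    (hl : IsNormalWord p l) (hm : IsNormalWord p m) (h : l.Perm m) : l = m :=
  List.Perm.eq_of_pairwise (le := (· ≤ ·)) (fun _ _ _ _ h1 h2 => le_antisymm h1 h2)
    (hl.imp fun h => h.elim le_of_lt fun h => h.1.le)
    (hm.imp fun h => h.elim le_of_lt fun h => h.1.le) h

section Current

variable {k L A D I : Type*} [Field k] [AddCommGroup L] [Module k L]
  [CommRing A] [Algebra k A] (β : Module.Basis I k L) (α : Module.Basis D k A)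

/-- The basis `β i ⊗ α r` of `L ⊗ A`, with indices arranged so that the lexicographic order
compares the degree `r` first. -/
def lexBasis : Module.Basis (D ×ₗ I) k (L ⊗[k] A) :=
  (β.tensorProduct α).reindex ((Equiv.prodComm I D).trans toLex)

theorem lexBasis_apply (r : D) (i : I) : lexBasis β α (toLex (r, i)) = β i ⊗ₜ[k] α r := by
  simp [lexBasis]

variable {β α} {𝓛 : ZMod 2 → Submodule k L} {q : I → ZMod 2}

theorem lexBasis_mem (hβ : ∀ i, β i ∈ 𝓛 (q i)) (x : D ×ₗ I) :
    lexBasis β α x ∈ tensorGrading 𝓛 A (q (ofLex x).2) := by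
  obtain ⟨r, i⟩ := x
  exact (lexBasis_apply β α r i).symm ▸ tmul_mem_tensorGrading (hβ i) (α r)

variable [CharZero k] [LieSuperalgebra 𝓛]

theorem tmul_mem_center {c : L} (hc : c ∈ center 𝓛) (a : A) :
    c ⊗ₜ[k] a ∈ center (tensorGrading 𝓛 A) := by
  rw [mem_center_iff]
  intro t
  induction t using TensorProduct.induction_on with
  | zero => simp
  | tmul y b => rw [tensor_bracket_tmul, mem_center_iff.mp hc, TensorProduct.zero_tmul]
  | add s t hs ht => rw [map_add, hs, ht, add_zero]

variable [LinearOrder D] [LinearOrder I]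

/-- Appending a letter of large degree to a normal word gives a normal word, whose coordinate can
be read off. -/
theorem coord_envWord_mul_ι {κ : Enveloping (tensorGrading 𝓛 A) →ₗ[k] List (D ×ₗ I) →₀ k}
    (hκ : ∀ w, IsNormalWord (fun x => q (ofLex x).2) w →
      κ (envWord (tensorGrading 𝓛 A) (lexBasis β α) w) = Finsupp.single w 1)
    {m : List (D ×ₗ I)} (hm : IsNormalWord (fun x => q (ofLex x).2) m) {s : D}
    (hs : ∀ x ∈ m, (ofLex x).1 < s) (v : L) (m₀ : List (D ×ₗ I)) (s₀ : D) (c₀ : I) :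
    κ (envWord (tensorGrading 𝓛 A) (lexBasis β α) m *
        Enveloping.ι (tensorGrading 𝓛 A) (v ⊗ₜ[k] α s)) (m₀ ++ [toLex (s₀, c₀)]) =
      if m = m₀ ∧ s = s₀ then β.repr v c₀ else 0 := by
  classical
  have hv := β.mem_span v
  induction hv using Submodule.span_induction with
  | zero => simp
  | add v w _ _ hv hw =>
    rw [TensorProduct.add_tmul, map_add, mul_add, map_add, Finsupp.add_apply, hv, hw]
    split_ifs <;> simp
  | smul r v _ hv =>
    rw [← TensorProduct.smul_tmul', map_smul, mul_smul_comm, map_smul, Finsupp.smul_apply, hv]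
    split_ifs <;> simp
  | mem v hv =>
    obtain ⟨c, rfl⟩ := hv
    have h1 : envWord (tensorGrading 𝓛 A) (lexBasis β α) m *
        Enveloping.ι (tensorGrading 𝓛 A) (β c ⊗ₜ[k] α s) =
        envWord (tensorGrading 𝓛 A) (lexBasis β α) (m ++ [toLex (s, c)]) := by
      rw [envWord_append, envWord_cons, envWord_nil, mul_one, lexBasis_apply]
    have h2 : IsNormalWord (fun x : D ×ₗ I => q (ofLex x).2) (m ++ [toLex (s, c)]) := by
      refine List.pairwise_append.mpr ⟨hm, List.pairwise_singleton _ _, fun x hx y hy => ?_⟩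
      rw [List.mem_singleton] at hy
      subst hy
      exact Or.inl (Prod.Lex.lt_iff.mpr (Or.inl (hs x hx)))
    rw [h1, hκ _ h2, Finsupp.single_apply, β.repr_self, Finsupp.single_apply, ← ite_and]
    refine if_congr ?_ rfl rfl
    constructor
    · intro h
      obtain ⟨h3, h4⟩ := List.append_inj' h rfl
      have h5 := Prod.mk.inj (toLex.injective (List.singleton_inj.mp h4))
      exact ⟨⟨h3, h5.1⟩, h5.2⟩
    · rintro ⟨⟨rfl, rfl⟩, rfl⟩
      rfl

variable [AddCommMonoid D] [IsOrderedCancelAddMonoid D]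

open Classical in
/-- The coordinate of the supercommutator of a normal word `w` with `y ⊗ α N` at a word ending with
a letter of degree `r₀ + N`, for large `N`: only the terms in which a letter of degree `r₀` was
removed contribute. -/
theorem coord_superCommutator (hα : ∀ r s, α r * α s = α (r + s)) (hβ : ∀ i, β i ∈ 𝓛 (q i))
    {κ : Enveloping (tensorGrading 𝓛 A) →ₗ[k] List (D ×ₗ I) →₀ k}
    (hκ : ∀ w, IsNormalWord (fun x => q (ofLex x).2) w →
      κ (envWord (tensorGrading 𝓛 A) (lexBasis β α) w) = Finsupp.single w 1)
    (hκ' : ∀ w, κ (envWord (tensorGrading 𝓛 A) (lexBasis β α) w) ∈ Finsupp.supported k k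
      {w' | w'.length ≤ w.length ∧ IsNormalWord (fun x => q (ofLex x).2) w'})
    {w : List (D ×ₗ I)} (hw : IsNormalWord (fun x => q (ofLex x).2) w) {N : D}
    (hN : ∀ x ∈ w, ∀ y ∈ w, (ofLex x).1 < (ofLex y).1 + N)
    {j : ZMod 2} {y : L} (hy : y ∈ 𝓛 j) (m₀ : List (D ×ₗ I)) (hm₀ : w.length ≤ m₀.length + 1)
    (r₀ : D) (c₀ : I) :
    κ (superCommutator (Enveloping.grading (tensorGrading 𝓛 A))
        (envWord (tensorGrading 𝓛 A) (lexBasis β α) w)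
        (Enveloping.ι (tensorGrading 𝓛 A) (y ⊗ₜ[k] α N))) (m₀ ++ [toLex (r₀ + N, c₀)]) =
      β.repr (bracket 𝓛 (Finsupp.linearCombination k (fun m : List (D ×ₗ I) × (D ×ₗ I) =>
        if m.1 = m₀ ∧ (ofLex m.2).1 = r₀ then β (ofLex m.2).2 else 0)
          (removeLetter k (fun x => q (ofLex x).2) w)) y) c₀ := by
  have h1 := superCommutator_envWord_sub_mem (lexBasis_mem (α := α) hβ) w
    (tmul_mem_tensorGrading hy (α N))
  have h2 : lengthLT (tensorGrading 𝓛 A) (lexBasis β α) w.length ≤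
      (Finsupp.supported k k {w' : List (D ×ₗ I) | w'.length < w.length}).comap κ := by
    refine Submodule.span_le.mpr ?_
    rintro _ ⟨w', hw', rfl⟩
    exact Finsupp.supported_mono (fun u hu => lt_of_le_of_lt hu.1 hw') (hκ' w')
  have h3 := (Finsupp.mem_supported' k _).mp (h2 h1) (m₀ ++ [toLex (r₀ + N, c₀)]) (by simpa using hm₀)
  rw [map_sub, Finsupp.sub_apply, sub_eq_zero] at h3
  rw [h3]
  -- Both sides are linear in the formal sum `removeLetter w`, so we can compare term by term.
  rw [Finsupp.linearCombination_apply, Finsupp.linearCombination_apply, Finsupp.sum, Finsupp.sum,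
    map_sum, Finsupp.finsetSum_apply, map_sum, LinearMap.sum_apply, map_sum,
    Finsupp.finsetSum_apply]
  refine Finset.sum_congr rfl fun m hm => ?_
  obtain ⟨m, x, rfl⟩ : ∃ m' x, m = (m', toLex x) := ⟨m.1, ofLex m.2, rfl⟩
  obtain ⟨r, i⟩ := x
  have hm' := Finsupp.mem_support_iff.mp hm
  have hsub := sublist_of_removeLetter_ne_zero hm'
  have hx : toLex (r, i) ∈ w :=
    (perm_of_removeLetter_ne_zero hm').symm.subset List.mem_cons_self
  have h4 := coord_envWord_mul_ι hκ (hw.sublist hsub) (s := r + N)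
    (fun x' hx' => hN x' (hsub.subset hx') _ hx) (bracket 𝓛 (β i) y) m₀ (r₀ + N) c₀
  rw [map_smul, map_smul, Finsupp.smul_apply, LinearMap.smul_apply, map_smul, Finsupp.smul_apply]
  congr 1
  rw [lexBasis_apply, tensor_bracket_tmul, hα, h4]
  by_cases h : (m, toLex (r, i)).1 = m₀ ∧ (ofLex (m, toLex (r, i)).2).1 = r₀
  · rw [if_pos h, if_pos ⟨h.1, congrArg (· + N) h.2⟩]
    rfl
  · rw [if_neg h, if_neg fun h' => h ⟨h'.1, add_right_cancel h'.2⟩]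
    simp

/-- The crucial step: a combination of normal words of length at most `n` that lies in the
supercenter contains no word of length `n` with a noncentral letter. -/
theorem mem_center_of_mem_support (hα : ∀ r s, α r * α s = α (r + s))
    (hD : ∀ F : Finset D, ∃ N, ∀ r ∈ F, ∀ s ∈ F, r < s + N) (hβ : ∀ i, β i ∈ 𝓛 (q i))
    (hC : ∀ c ∈ center 𝓛, ∀ i, β i ∉ center 𝓛 → β.repr c i = 0)
    {f : List (D ×ₗ I) →₀ k} {n : ℕ}
    (hf : ∀ w ∈ f.support, w.length ≤ n ∧ IsNormalWord (fun x => q (ofLex x).2) w)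
    (hz : Finsupp.linearCombination k (envWord (tensorGrading 𝓛 A) (lexBasis β α)) f ∈
      superCenter (Enveloping.grading (tensorGrading 𝓛 A)))
    {w₀ : List (D ×ₗ I)} (hw₀ : w₀ ∈ f.support) (hlen : w₀.length = n) {x₀ : D ×ₗ I}
    (hx₀ : x₀ ∈ w₀) : β (ofLex x₀).2 ∈ center 𝓛 := by
  classical
  by_contra hnc
  obtain ⟨r₀, i₀⟩ := x₀
  change β i₀ ∉ center 𝓛 at hnc
  replace hx₀ : toLex (r₀, i₀) ∈ w₀ := hx₀
  obtain ⟨κ, hκ, hκ'⟩ := exists_normalCoord (tensorGrading 𝓛 A) (lexBasis β α)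
    (lexBasis_mem (α := α) hβ)
  obtain ⟨N, hN⟩ := hD (f.support.biUnion fun w => (w.map fun x => (ofLex x).1).toFinset)
  have hdeg : ∀ w ∈ f.support, ∀ x ∈ w,
      (ofLex x).1 ∈ f.support.biUnion fun w => (w.map fun x => (ofLex x).1).toFinset :=
    fun w hw x hx => Finset.mem_biUnion.mpr ⟨w, hw, by
      rw [List.mem_toFinset]
      exact List.mem_map_of_mem hx⟩
  set m₀ := w₀.erase (toLex (r₀, i₀)) with hm₀
  have hm₀len : m₀.length + 1 = n := by
    rw [hm₀, List.length_erase_of_mem hx₀, ← hlen]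
    have := List.length_pos_of_mem hx₀
    omega
  set T : (List (D ×ₗ I) × (D ×ₗ I) →₀ k) →ₗ[k] L :=
    Finsupp.linearCombination k fun m : List (D ×ₗ I) × (D ×ₗ I) =>
      if m.1 = m₀ ∧ (ofLex m.2).1 = r₀ then β (ofLex m.2).2 else 0 with hT
  -- The combination `a` of the basis vectors that complete `m₀` to words in `f` is central.
  set a : L := f.sum fun w c => c • T (removeLetter k (fun x => q (ofLex x).2) w) with ha
  have hcen : a ∈ center 𝓛 := by
    refine mem_center_of_homogeneous fun j y hy => ?_
    refine β.repr.injective (Finsupp.ext fun c₀ => ?_)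
    have h1 : superCommutator (Enveloping.grading (tensorGrading 𝓛 A))
      (Finsupp.linearCombination k (envWord (tensorGrading 𝓛 A) (lexBasis β α)) f)
      (Enveloping.ι (tensorGrading 𝓛 A) (y ⊗ₜ[k] α N)) = 0 := hz _
    rw [superCommutator_linearCombination] at h1
    have h2 := congrArg (fun u => κ u (m₀ ++ [toLex (r₀ + N, c₀)])) h1
    simp only [Finsupp.sum, map_sum, map_smul, map_zero, Finsupp.coe_zero, Pi.zero_apply,
      Finsupp.finsetSum_apply, Finsupp.smul_apply] at h2
    rw [ha, Finsupp.sum, map_sum, LinearMap.sum_apply, map_sum, Finsupp.finsetSum_apply, map_zero,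
      Finsupp.zero_apply, ← h2]
    refine Finset.sum_congr rfl fun w hw => ?_
    rw [coord_superCommutator hα hβ hκ hκ' (hf w hw).2
      (fun x hx y hy => hN _ (hdeg w hw x hx) _ (hdeg w hw y hy)) hy m₀
      (hm₀len ▸ (hf w hw).1) r₀ c₀]
    rw [map_smul, LinearMap.smul_apply, map_smul, Finsupp.smul_apply]
  -- Its coordinate at the noncentral `β i₀` only involves the word `w₀` and does not vanish.
  have hTcoord : ∀ g, β.repr (T g) i₀ = g (m₀, toLex (r₀, i₀)) := fun g => by
    induction g using Finsupp.induction_linear with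
    | zero => simp
    | add g h hg hh => rw [map_add, map_add, Finsupp.add_apply, Finsupp.add_apply, hg, hh]
    | single m c =>
      obtain ⟨m, x, rfl⟩ : ∃ m' x, m = (m', toLex x) := ⟨m.1, ofLex m.2, rfl⟩
      obtain ⟨r, i⟩ := x
      rw [hT, Finsupp.linearCombination_single, map_smul, Finsupp.smul_apply]
      by_cases h : (m, toLex (r, i)).1 = m₀ ∧ (ofLex (m, toLex (r, i)).2).1 = r₀
      · rw [if_pos h]
        obtain ⟨rfl, rfl⟩ : m = m₀ ∧ r = r₀ := h
        simp [Finsupp.single_apply]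
      · rw [if_neg h, Finsupp.single_eq_of_ne, map_zero, Finsupp.zero_apply, smul_zero]
        intro h'
        have h1 := Prod.mk.inj h'
        exact h ⟨h1.1.symm, (Prod.mk.inj (toLex.injective h1.2)).1.symm⟩
  have h0 := hC a hcen i₀ hnc
  rw [ha, Finsupp.sum, map_sum, Finsupp.finsetSum_apply, Finset.sum_eq_single w₀] at h0
  · rw [map_smul, Finsupp.smul_apply, hTcoord, smul_eq_mul, mul_eq_zero] at h0
    rcases h0 with h0 | h0
    · exact Finsupp.mem_support_iff.mp hw₀ h0
    · refine removeLetter_erase_ne_zero (k := k) (hf w₀ hw₀).2 hx₀ ?_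
      convert h0
  · intro w hw hne
    rw [map_smul, Finsupp.smul_apply, hTcoord]
    by_contra h
    have h1 : removeLetter k (fun x => q (ofLex x).2) w (m₀, toLex (r₀, i₀)) ≠ 0 :=
      fun h' => h (by rw [h', smul_zero])
    exact hne ((hf w hw).2.eq_of_perm (hf w₀ hw₀).2
      ((perm_of_removeLetter_ne_zero h1).trans (List.perm_cons_erase hx₀).symm))
  · exact fun h => absurd hw₀ h

/-- The supercenter for a homogeneous basis `β` adapted to the center: by `hC`, central elements
have no coordinates at the noncentral members of `β`. -/
theorem superCenter_eq_adjoin (hα : ∀ r s, α r * α s = α (r + s))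
    (hD : ∀ F : Finset D, ∃ N, ∀ r ∈ F, ∀ s ∈ F, r < s + N) (hβ : ∀ i, β i ∈ 𝓛 (q i))
    (hC : ∀ c ∈ center 𝓛, ∀ i, β i ∉ center 𝓛 → β.repr c i = 0) :
    superCenter (Enveloping.grading (tensorGrading 𝓛 A)) =
      Algebra.adjoin k {u | ∃ c ∈ center 𝓛, ∃ r : D,
        u = Enveloping.ι (tensorGrading 𝓛 A) (c ⊗ₜ[k] α r)} := by
  classical
  set Z := Algebra.adjoin k {u | ∃ c ∈ center 𝓛, ∃ r : D,
        u = Enveloping.ι (tensorGrading 𝓛 A) (c ⊗ₜ[k] α r)} with hZ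
  have hle : Z ≤ superCenter (Enveloping.grading (tensorGrading 𝓛 A)) := by
    refine Algebra.adjoin_le ?_
    rintro _ ⟨c, hc, r, rfl⟩
    exact ι_mem_superCenter (tmul_mem_center hc (α r))
  refine le_antisymm (fun z hz => ?_) hle
  have key : ∀ n, ∀ z ∈ superCenter (Enveloping.grading (tensorGrading 𝓛 A)),
      z ∈ lengthLT (tensorGrading 𝓛 A) (lexBasis β α) n → z ∈ Z := by
    intro n
    induction n with
    | zero =>
      intro z _ hzn
      have : z = 0 := by simpa [lengthLT] using hzn
      rw [this]
      exact zero_mem _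
    | succ n ih =>
      intro z hz hzn
      have h1 : z ∈ Submodule.span k (envWord (tensorGrading 𝓛 A) (lexBasis β α) ''
          {w | w.length ≤ n ∧ IsNormalWord (fun x => q (ofLex x).2) w}) := by
        refine Submodule.span_le.mpr ?_ hzn
        rintro _ ⟨w, hw, rfl⟩
        have hsub : {w' : List (D ×ₗ I) | w'.length ≤ w.length ∧
            IsNormalWord (fun x => q (ofLex x).2) w'} ⊆
            {w | w.length ≤ n ∧ IsNormalWord (fun x => q (ofLex x).2) w} :=
          fun w' hw' => ⟨hw'.1.trans (Nat.lt_succ_iff.mp hw), hw'.2⟩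
        exact Submodule.span_mono (Set.image_mono hsub)
          (envWord_mem_span_normal (tensorGrading 𝓛 A) (lexBasis β α) (lexBasis_mem hβ) w)
      obtain ⟨f, hf, rfl⟩ := (Finsupp.mem_span_image_iff_linearCombination k).mp h1
      have htop : ∀ w ∈ f.support, w.length = n →
          envWord (tensorGrading 𝓛 A) (lexBasis β α) w ∈ Z := by
        intro w hw hwn
        refine list_prod_mem fun u hu => ?_
        obtain ⟨x, hx, rfl⟩ := List.mem_map.mp hu
        refine Algebra.subset_adjoin ⟨β (ofLex x).2, ?_, (ofLex x).1, ?_⟩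
        · exact mem_center_of_mem_support hα hD hβ hC (fun w hw => hf hw) hz hw hwn hx
        · rw [← lexBasis_apply]
          rfl
      have hz' : f.sum (fun w c => if w.length = n then
          c • envWord (tensorGrading 𝓛 A) (lexBasis β α) w else 0) ∈ Z :=
        sum_mem fun w hw => by
          dsimp only
          split_ifs with h
          · exact Z.smul_mem (htop w hw h) _
          · exact zero_mem _
      have h2 := ih _ (sub_mem hz (hle hz')) (by
        rw [Finsupp.linearCombination_apply, ← Finsupp.sum_sub]
        refine sum_mem fun w hw => ?_
        dsimp only
        split_ifs with h
        · rw [sub_self]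
          exact zero_mem _
        · rw [sub_zero]
          exact Submodule.smul_mem _ _ (envWord_mem_lengthLT (lt_of_le_of_ne (hf hw).1 h)))
      have := add_mem h2 hz'
      rwa [sub_add_cancel] at this
  -- Every element is a combination of finitely many words, hence of bounded length.
  have hbound : ∃ n, z ∈ lengthLT (tensorGrading 𝓛 A) (lexBasis β α) n := by
    have hspan := mem_span_envWord (tensorGrading 𝓛 A) (lexBasis β α) z
    clear hz
    induction hspan using Submodule.span_induction with
    | zero => exact ⟨0, zero_mem _⟩
    | add v w _ _ hv hw =>
      obtain ⟨m, hm⟩ := hv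
      obtain ⟨n, hn⟩ := hw
      exact ⟨max m n, add_mem (lengthLT_mono (le_max_left _ _) hm)
        (lengthLT_mono (le_max_right _ _) hn)⟩
    | smul r v _ hv =>
      obtain ⟨m, hm⟩ := hv
      exact ⟨m, Submodule.smul_mem _ r hm⟩
    | mem v hv =>
      obtain ⟨w, rfl⟩ := hv
      exact ⟨w.length + 1, envWord_mem_lengthLT (Nat.lt_succ_self _)⟩
  obtain ⟨n, hn⟩ := hbound
  exact key n z hz hn

end Current

end LieSuperalgebra
end

noncomputable section

/-! ### Freely generated subalgebras -/

section FreelyGenerated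

variable {k A B σ : Type*} [CommRing k] [Ring A] [Algebra k A] [Ring B] [Algebra k B]

open scoped IsMulCommutative in
/-- A subalgebra generated by commuting elements is freely generated by them if the monomials,
evaluated with any chosen order `l m` of the factors of each monomial `m`, are linearly
independent. -/
theorem isFreelyGeneratedBy_adjoin {g : σ → A} (hg : ∀ s t, g s * g t = g t * g s)
    (l : (σ →₀ ℕ) → List σ) (hl : ∀ m, (l m : Multiset σ) = Finsupp.toMultiset m)
    (hli : LinearIndependent k fun m => ((l m).map g).prod) :
    IsFreelyGeneratedBy (Algebra.adjoin k (Set.range g)) g := by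
  have hcomm : IsMulCommutative (Algebra.adjoin k (Set.range g)) :=
    Algebra.isMulCommutative_adjoin k (by rintro _ ⟨s, rfl⟩ _ ⟨t, rfl⟩; exact hg s t)
  let g' : σ → Algebra.adjoin k (Set.range g) := fun s => ⟨g s, Algebra.subset_adjoin ⟨s, rfl⟩⟩
  let φ : MvPolynomial σ k →ₐ[k] Algebra.adjoin k (Set.range g) := MvPolynomial.aeval g'
  have hφX : ∀ s, φ (MvPolynomial.X s) = g' s := fun s => MvPolynomial.aeval_X g' s
  let ψ : MvPolynomial σ k →ₐ[k] A := (Algebra.adjoin k (Set.range g)).val.comp φ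
  have hψX : ∀ s, ψ (MvPolynomial.X s) = g s := fun s => congrArg Subtype.val (hφX s)
  have hmon : ∀ m, ψ (MvPolynomial.basisMonomials σ k m) = ((l m).map g).prod := fun m => by
    have h1 : MvPolynomial.basisMonomials σ k m = ((l m).map MvPolynomial.X).prod := by
      rw [MvPolynomial.coe_basisMonomials]
      dsimp only
      rw [MvPolynomial.monomial_eq, map_one, one_mul,
        ← Multiset.prod_coe, ← Multiset.map_coe, hl, Finsupp.toMultiset_map, Finsupp.prod_toMultiset]
      exact (Finsupp.prod_mapDomain_index (by simp) (by intros; rw [pow_add])).symm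
    rw [h1, map_list_prod, List.map_map]
    congr 1
    exact List.map_congr_left fun s _ => hψX s
  have hinj : Function.Injective φ := by
    have h1 : LinearMap.ker ψ.toLinearMap = ⊥ := by
      refine LinearMap.ker_eq_bot'.mpr fun f hf => ?_
      rw [← (MvPolynomial.basisMonomials σ k).linearCombination_repr f] at hf ⊢
      rw [Finsupp.apply_linearCombination] at hf
      have h2 : ψ.toLinearMap ∘ MvPolynomial.basisMonomials σ k = fun m => ((l m).map g).prod :=
        funext hmon
      rw [h2] at hf
      rw [linearIndependent_iff.mp hli _ hf, map_zero]
    have h2 : Function.Injective ψ := LinearMap.ker_eq_bot.mp h1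
    exact Function.Injective.of_comp (f := Subtype.val) h2
  have hsurj : Function.Surjective φ := by
    have h1 : Algebra.adjoin k (Set.range g) ≤ ψ.range := by
      refine Algebra.adjoin_le ?_
      rintro _ ⟨s, rfl⟩
      exact ⟨MvPolynomial.X s, hψX s⟩
    intro z
    obtain ⟨f, hf⟩ := h1 z.2
    exact ⟨f, Subtype.ext hf⟩
  exact ⟨AlgEquiv.ofBijective φ ⟨hinj, hsurj⟩, fun s => congrArg Subtype.val (hφX s)⟩

theorem IsFreelyGeneratedBy.map {Z : Subalgebra k A} {g : σ → A} (h : IsFreelyGeneratedBy Z g)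
    (Ψ : A ≃ₐ[k] B) : IsFreelyGeneratedBy (Z.map (Ψ : A →ₐ[k] B)) fun s => Ψ (g s) := by
  obtain ⟨φ, hφ⟩ := h
  exact ⟨φ.trans (Ψ.subalgebraMap Z), fun s => congrArg Ψ (hφ s)⟩

end FreelyGenerated

namespace LieSuperalgebra

/-! ### The supercenter in terms of a basis of the center -/

section Basis

variable {k L : Type*} [Field k] [CharZero k] [AddCommGroup L] [Module k L]
  {𝓛 : ZMod 2 → Submodule k L} [LieSuperalgebra 𝓛]

/-- Every basis of the center consisting of homogeneous elements extends to a homogeneous basis. -/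
theorem exists_homogeneous_basis {s : Set L} (hs : LinearIndepOn k id s)
    (hhom : ∀ v ∈ s, ∃ i, v ∈ 𝓛 i) (hspan : Submodule.span k s = center 𝓛) :
    ∃ (I : Set L) (β : Module.Basis I k L) (q : I → ZMod 2), s ⊆ I ∧ (∀ i, β i = i) ∧
      (∀ i, β i ∈ 𝓛 (q i)) ∧ ∀ c ∈ center 𝓛, ∀ i, β i ∉ center 𝓛 → β.repr c i = 0 := by
  obtain ⟨I, hI, hsI, htI, hli⟩ := exists_linearIndepOn_id_extension hs
    (t := {v | ∃ i, v ∈ 𝓛 i}) hhom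
  have htop : ⊤ ≤ Submodule.span k (Set.range fun i : I => (i : L)) := by
    rw [Subtype.range_coe_subtype, Set.ofPred_mem_eq]
    intro v _
    rw [← sum_decompose_eq (𝓥 := 𝓛) v]
    exact sum_mem fun i _ => htI ⟨i, SetLike.coe_mem _⟩
  let β : Module.Basis I k L := Module.Basis.mk hli htop
  have hβ : ∀ i, β i = i := fun i => Module.Basis.mk_apply hli htop i
  choose q hq using fun i : I => hI i.2
  refine ⟨I, β, q, hsI, hβ, fun i => (hβ i).symm ▸ hq i, fun c hc i hi => ?_⟩
  have h1 : c ∈ Submodule.span k (β '' {i | β i ∈ center 𝓛}) := by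
    rw [← hspan] at hc
    refine Submodule.span_mono ?_ hc
    intro v hv
    refine ⟨⟨v, hsI hv⟩, ?_, hβ _⟩
    have : v ∈ center 𝓛 := hspan ▸ Submodule.subset_span hv
    rw [Set.mem_ofPred_eq, hβ]
    exact this
  by_contra h
  exact hi (β.mem_span_image.mp h1 (Finsupp.mem_support_iff.mpr h))

theorem exists_homogeneous_center_basis :
    ∃ s : Set L, LinearIndepOn k id s ∧ (∀ v ∈ s, ∃ i, v ∈ 𝓛 i) ∧
      Submodule.span k s = center 𝓛 := by
  obtain ⟨s, hs, hspan, hli⟩ := exists_linearIndependent k {v | v ∈ center 𝓛 ∧ ∃ i, v ∈ 𝓛 i}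
  refine ⟨s, hli, fun v hv => (hs hv).2, hspan.trans (le_antisymm ?_ fun c hc => ?_)⟩
  · exact Submodule.span_le.mpr fun v hv => hv.1
  · rw [← sum_decompose_eq (𝓥 := 𝓛) c]
    exact sum_mem fun i _ =>
      Submodule.subset_span ⟨decompose_mem_center hc i, i, SetLike.coe_mem _⟩

variable {A D J : Type*} [CommRing A] [Algebra k A] (α : Module.Basis D k A)
  [LinearOrder D] [AddCommMonoid D] [IsOrderedCancelAddMonoid D]

/-- The generators of the supercenter may be taken from any basis of the center, homogeneous or
not. -/
theorem superCenter_eq_adjoin_range (hα : ∀ r s, α r * α s = α (r + s))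
    (hD : ∀ F : Finset D, ∃ N, ∀ r ∈ F, ∀ s ∈ F, r < s + N) {e : J → L}
    (hspan : Submodule.span k (Set.range e) = center 𝓛) :
    superCenter (Enveloping.grading (tensorGrading 𝓛 A)) =
      Algebra.adjoin k (Set.range fun p : J × D =>
        Enveloping.ι (tensorGrading 𝓛 A) (e p.1 ⊗ₜ[k] α p.2)) := by
  obtain ⟨s, hs, hhom, hs'⟩ := exists_homogeneous_center_basis (𝓛 := 𝓛)
  obtain ⟨I, β, q, -, -, hβ, hC⟩ := exists_homogeneous_basis hs hhom hs'
  let _ : LinearOrder I := IsWellOrder.linearOrder WellOrderingRel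
  rw [superCenter_eq_adjoin hα hD hβ hC]
  refine le_antisymm (Algebra.adjoin_le ?_) (Algebra.adjoin_mono ?_)
  · rintro _ ⟨c, hc, r, rfl⟩
    rw [← hspan] at hc
    induction hc using Submodule.span_induction with
    | zero =>
      rw [TensorProduct.zero_tmul, map_zero]
      exact zero_mem _
    | add v w _ _ hv hw =>
      rw [TensorProduct.add_tmul, map_add]
      exact add_mem hv hw
    | smul a v _ hv =>
      rw [← TensorProduct.smul_tmul', map_smul]
      exact Subalgebra.smul_mem _ hv a
    | mem v hv =>
      obtain ⟨j, rfl⟩ := hv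
      exact Algebra.subset_adjoin ⟨(j, r), rfl⟩
  · rintro _ ⟨p, rfl⟩
    exact ⟨e p.1, hspan ▸ Submodule.subset_span ⟨p.1, rfl⟩, p.2, rfl⟩

/-- If the center is even, then the increasing monomials in a basis of the center are normal words,
hence linearly independent. -/
theorem isFreelyGeneratedBy_superCenter (hα : ∀ r s, α r * α s = α (r + s))
    (hD : ∀ F : Finset D, ∃ N, ∀ r ∈ F, ∀ s ∈ F, r < s + N) {e : J → L}
    (he : LinearIndependent k e) (hspan : Submodule.span k (Set.range e) = center 𝓛)
    (heven : center 𝓛 ≤ 𝓛 0) :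
    IsFreelyGeneratedBy (superCenter (Enveloping.grading (tensorGrading 𝓛 A)))
      fun p : J × D => Enveloping.ι (tensorGrading 𝓛 A) (e p.1 ⊗ₜ[k] α p.2) := by
  rw [superCenter_eq_adjoin_range α hα hD hspan]
  have hcen : ∀ j, e j ∈ center 𝓛 := fun j => hspan ▸ Submodule.subset_span ⟨j, rfl⟩
  obtain ⟨I, β, q, hsI, hβI, hβ, -⟩ := exists_homogeneous_basis (𝓛 := 𝓛) he.linearIndepOn_id
    (by rintro _ ⟨j, rfl⟩; exact ⟨0, heven (hcen j)⟩) hspan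
  let _ : LinearOrder I := IsWellOrder.linearOrder WellOrderingRel
  let idx : J → I := fun j => ⟨e j, hsI ⟨j, rfl⟩⟩
  have hidx : Function.Injective idx := fun i j h => he.injective (congrArg Subtype.val h)
  have hq : ∀ j, q (idx j) = 0 := fun j => by
    by_contra h
    have h1 := DirectSum.decompose_of_mem_ne 𝓛 (hβ (idx j)) h
    have h2 : β (idx j) = e j := hβI _
    rw [h2, DirectSum.decompose_of_mem_same 𝓛 (heven (hcen j))] at h1
    exact he.ne_zero j h1
  let τ : J × D → D ×ₗ I := fun p => toLex (p.2, idx p.1)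
  have hτ : Function.Injective τ := fun p p' h => by
    have h1 := Prod.mk.inj (toLex.injective h)
    exact Prod.ext (hidx h1.2) h1.1
  -- Write the factors of each monomial in increasing order.
  let l : (J × D →₀ ℕ) → List (J × D) := fun m =>
    (Finsupp.toMultiset m).toList.mergeSort fun a c => decide (τ a ≤ τ c)
  have hl : ∀ m, (l m : Multiset (J × D)) = Finsupp.toMultiset m := fun m => by
    rw [← Multiset.coe_toList (Finsupp.toMultiset m)]
    exact Multiset.coe_eq_coe.mpr (List.mergeSort_perm _ _)
  have hnormal : ∀ m, IsNormalWord (fun x : D ×ₗ I => q (ofLex x).2) ((l m).map τ) := fun m => by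
    have h1 := List.pairwise_mergeSort (le := fun a c => decide (τ a ≤ τ c))
      (by simpa using fun a b c (h : τ a ≤ τ b) (h' : τ b ≤ τ c) => h.trans h')
      (by simpa using fun a b => le_total (τ a) (τ b)) (Finsupp.toMultiset m).toList
    refine List.pairwise_map.mpr (h1.imp fun {a c} h => ?_)
    rcases lt_or_eq_of_le (of_decide_eq_true h) with h' | h'
    · exact Or.inl h'
    · exact Or.inr ⟨h', hq a.1⟩
  refine isFreelyGeneratedBy_adjoin (fun s t => ?_) l hl ?_
  · have h1 := Enveloping.ι_bracket (tensorGrading 𝓛 A)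
      (tmul_mem_tensorGrading (heven (hcen s.1)) (α s.2))
      (tmul_mem_tensorGrading (heven (hcen t.1)) (α t.2))
    rw [mem_center_iff.mp (tmul_mem_center (hcen s.1) (α s.2)), map_zero, koszulSign_zero_left,
      one_smul, sub_eq_zero] at h1
    exact h1
  · obtain ⟨κ, hκ, -⟩ := exists_normalCoord (tensorGrading 𝓛 A) (lexBasis β α)
      (lexBasis_mem (α := α) hβ)
    have h1 : ∀ m, ((l m).map fun p : J × D =>
        Enveloping.ι (tensorGrading 𝓛 A) (e p.1 ⊗ₜ[k] α p.2)).prod =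
        envWord (tensorGrading 𝓛 A) (lexBasis β α) ((l m).map τ) := fun m => by
      rw [envWord, List.map_map]
      congr 1
      refine List.map_congr_left fun p _ => ?_
      have h2 : β (idx p.1) = e p.1 := hβI _
      rw [Function.comp_apply, lexBasis_apply, h2]
    simp_rw [h1]
    refine LinearIndependent.of_comp κ ?_
    have h2 : κ ∘ (fun m => envWord (tensorGrading 𝓛 A) (lexBasis β α) ((l m).map τ)) =
        (fun w => Finsupp.single w (1 : k)) ∘ fun m => (l m).map τ :=
      funext fun m => hκ _ (hnormal m)
    rw [h2]
    refine (Finsupp.linearIndependent_single_one k _).comp _ fun m m' h => ?_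
    have h3 : l m = l m' := List.map_injective_iff.mpr hτ h
    classical
    rw [← Finsupp.toMultiset_toFinsupp m, ← Finsupp.toMultiset_toFinsupp m', ← hl, ← hl, h3]

end Basis

end LieSuperalgebra
end

noncomputable section

namespace LieSuperalgebra

/-! ### Lie algebras as purely even Lie superalgebras -/

section PurelyEven

attribute [local instance] LieRing.ofAssociativeRing

variable {k V : Type*} [Field k] [CharZero k] [AddCommGroup V] [Module k V]
  {𝓥 : ZMod 2 → Submodule k V} [LieSuperalgebra 𝓥]

theorem enveloping_grading_zero_eq_top (h : 𝓥 0 = ⊤) : Enveloping.grading 𝓥 0 = ⊤ := by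
  let b := Module.Basis.ofVectorSpace k V
  have hb : ∀ x, b x ∈ 𝓥 0 := fun x => h ▸ Submodule.mem_top
  rw [eq_top_iff]
  intro u _
  refine Submodule.span_le.mpr ?_ (mem_span_envWord 𝓥 b u)
  rintro _ ⟨w, rfl⟩
  have h1 := envWord_mem_grading (p := fun _ => 0) hb w
  simpa using h1

/-- If all elements are even, the supercommutator is the commutator. -/
theorem superCenter_eq_center_of_even (h : 𝓥 0 = ⊤) :
    superCenter (Enveloping.grading 𝓥) = Subalgebra.center k (Enveloping 𝓥) := by
  have h0 : ∀ u, u ∈ Enveloping.grading 𝓥 0 := fun u =>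
    enveloping_grading_zero_eq_top h ▸ Submodule.mem_top
  ext z
  have h1 : z ∈ superCenter (Enveloping.grading 𝓥) ↔
      ∀ u, superCommutator (Enveloping.grading 𝓥) z u = 0 := Iff.rfl
  rw [h1, Subalgebra.mem_center_iff]
  refine forall_congr' fun u => ?_
  rw [superCommutator_of_mem _ (h0 z) (h0 u), koszulSign_zero_left, one_smul, sub_eq_zero, eq_comm]

/-- The enveloping algebra of a Lie algebra, and the enveloping superalgebra of the same Lie algebra
regarded as a purely even Lie superalgebra. -/
def envelopingEquiv {W : Type*} [LieRing W] [LieAlgebra k W] (θ : W ≃ₗ[k] V) (h : 𝓥 0 = ⊤)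
    (hθ : ∀ x y, θ ⁅x, y⁆ = bracket 𝓥 (θ x) (θ y)) :
    UniversalEnvelopingAlgebra k W ≃ₐ[k] Enveloping 𝓥 :=
  have h0 : ∀ v, v ∈ 𝓥 0 := fun v => h ▸ Submodule.mem_top
  have h1 : ∀ i, ∀ v ∈ 𝓥 i, i ≠ 0 → v = 0 := fun i v hv hi => by
    rw [← DirectSum.decompose_of_mem_same 𝓥 (h0 v), DirectSum.decompose_of_mem_ne 𝓥 hv hi]
  let f : W →ₗ⁅k⁆ Enveloping 𝓥 :=
    { toLinearMap := Enveloping.ι 𝓥 ∘ₗ θ.toLinearMap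
      map_lie' := fun {x y} => by
        have := Enveloping.ι_bracket 𝓥 (h0 (θ x)) (h0 (θ y))
        rw [koszulSign_zero_left, one_smul] at this
        rw [LieRing.of_associative_ring_bracket]
        simpa [hθ] using this.symm }
  let g : Enveloping 𝓥 →ₐ[k] UniversalEnvelopingAlgebra k W :=
    Enveloping.lift 𝓥 ((UniversalEnvelopingAlgebra.ι k : W →ₗ⁅k⁆ _).toLinearMap ∘ₗ θ.symm.toLinearMap) (by
      intro i j x y hx hy
      by_cases hi : i = 0
      · have h2 : θ.symm (bracket 𝓥 x y) = ⁅θ.symm x, θ.symm y⁆ := by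
          rw [LinearEquiv.symm_apply_eq, hθ, LinearEquiv.apply_symm_apply,
            LinearEquiv.apply_symm_apply]
        rw [hi, koszulSign_zero_left, one_smul]
        simp [h2, LieRing.of_associative_ring_bracket]
      · rw [h1 i x hx hi]
        simp)
  AlgEquiv.ofAlgHom (UniversalEnvelopingAlgebra.lift k f) g
    (Enveloping.algHom_ext 𝓥 fun v => by
      rw [AlgHom.comp_apply, Enveloping.lift_ι]
      refine (UniversalEnvelopingAlgebra.lift_ι_apply k f (θ.symm v)).trans ?_
      exact congrArg (Enveloping.ι 𝓥) (θ.apply_symm_apply v))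
    (UniversalEnvelopingAlgebra.hom_ext k (by
      ext w
      have h2 : g (f w) = UniversalEnvelopingAlgebra.ι k w := by
        change g (Enveloping.ι 𝓥 (θ w)) = _
        rw [Enveloping.lift_ι]
        simp
      simpa using h2))

theorem envelopingEquiv_ι {W : Type*} [LieRing W] [LieAlgebra k W] (θ : W ≃ₗ[k] V) (h : 𝓥 0 = ⊤)
    (hθ : ∀ x y, θ ⁅x, y⁆ = bracket 𝓥 (θ x) (θ y)) (w : W) :
    envelopingEquiv θ h hθ (UniversalEnvelopingAlgebra.ι k w) = Enveloping.ι 𝓥 (θ w) := by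
  exact UniversalEnvelopingAlgebra.lift_ι_apply k _ w

end PurelyEven

section LieAlgebra

variable (k L : Type*) [Field k] [LieRing L] [LieAlgebra k L]

/-- The grading of a module in which all elements are even. -/
def evenGrading : ZMod 2 → Submodule k L := fun i => if i = 0 then ⊤ else ⊥

variable {k L} in
theorem eq_zero_of_mem_evenGrading {i : ZMod 2} (hi : i ≠ 0) {x : L}
    (hx : x ∈ evenGrading k L i) : x = 0 := by
  simpa [evenGrading, hi] using hx

instance evenGrading.decomposition : DirectSum.Decomposition (evenGrading k L) :=
  DirectSum.Decomposition.ofLinearMap (evenGrading k L)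
    (DirectSum.lof k (ZMod 2) (fun i => evenGrading k L i) 0 ∘ₗ
      LinearMap.codRestrict (evenGrading k L 0) LinearMap.id fun _ => by simp [evenGrading])
    (by
      ext x
      rw [LinearMap.comp_apply, LinearMap.comp_apply, DirectSum.coeLinearMap_lof]
      rfl)
    (by
      ext i x : 2
      rw [LinearMap.comp_apply, LinearMap.comp_apply, LinearMap.comp_apply,
        DirectSum.coeLinearMap_lof]
      by_cases hi : i = 0
      · subst hi
        rfl
      · have hx : x = 0 := Subtype.ext (eq_zero_of_mem_evenGrading hi x.2)
        rw [hx]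
        simp)

theorem evenGrading_zero : evenGrading k L 0 = ⊤ := by simp [evenGrading]

theorem tensorGrading_evenGrading_zero (A : Type*) [CommRing A] [Algebra k A] :
    tensorGrading (evenGrading k L) A 0 = ⊤ := by
  rw [eq_top_iff]
  intro t _
  induction t using TensorProduct.induction_on with
  | zero => exact zero_mem _
  | tmul x a => exact tmul_mem_tensorGrading (by simp [evenGrading]) a
  | add s t hs ht => exact add_mem (hs trivial) (ht trivial)

variable [CharZero k]

/-- A Lie algebra, regarded as a purely even Lie superalgebra. -/
instance ofLieAlgebra : LieSuperalgebra (evenGrading k L) where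
  bracket := LieModule.toEnd k L L
  bracket_mem i j x y hx hy := by
    by_cases h : i + j = 0
    · simp [evenGrading, h]
    · by_cases hi : i = 0
      · rw [eq_zero_of_mem_evenGrading (fun hj => h (by rw [hi, hj, add_zero])) hy, map_zero]
        exact zero_mem _
      · rw [eq_zero_of_mem_evenGrading hi hx, map_zero, LinearMap.zero_apply]
        exact zero_mem _
  bracket_skew i j x y hx hy := by
    by_cases hi : i = 0
    · rw [hi, koszulSign_zero_left, one_smul]
      exact (lie_skew x y).symm
    · rw [eq_zero_of_mem_evenGrading hi hx]
      simp
  bracket_jacobi i j x y hx hy z := by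
    by_cases hi : i = 0
    · rw [hi, koszulSign_zero_left, one_smul]
      exact leibniz_lie x y z
    · rw [eq_zero_of_mem_evenGrading hi hx]
      simp

/-- The bracket of the extension of scalars `A ⊗ L` of a Lie algebra agrees with that of the Lie
superalgebra `L ⊗ A`. -/
theorem comm_lie (A : Type*) [CommRing A] [Algebra k A] (s t : A ⊗[k] L) :
    TensorProduct.comm k A L ⁅s, t⁆ = (tensor (evenGrading k L) A).bracket
      (TensorProduct.comm k A L s) (TensorProduct.comm k A L t) := by
  induction s using TensorProduct.induction_on with
  | zero => simp
  | add s s' hs hs' => simp only [add_lie, map_add, hs, hs', LinearMap.add_apply]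
  | tmul a x =>
    induction t using TensorProduct.induction_on with
    | zero => simp
    | add t t' ht ht' => simp only [lie_add, map_add, ht, ht']
    | tmul b y =>
      rw [LieAlgebra.ExtendScalars.bracket_tmul]
      simp only [TensorProduct.comm_tmul, tensor_bracket_tmul]
      rfl

theorem span_range_center_basis {J : Type*} (e : Module.Basis J k (LieAlgebra.center k L)) :
    Submodule.span k (Set.range fun j => (e j : L)) = center (evenGrading k L) := by
  have h1 : center (evenGrading k L) = (LieAlgebra.center k L).toSubmodule := by
    ext c
    rw [mem_center_iff, LieSubmodule.mem_toSubmodule, LieModule.mem_maxTrivSubmodule]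
    refine forall_congr' fun y => ?_
    change ⁅c, y⁆ = 0 ↔ ⁅y, c⁆ = 0
    rw [← lie_skew, neg_eq_zero]
  have h2 := congrArg (Submodule.map (LieAlgebra.center k L).toSubmodule.subtype) e.span_eq
  rw [Submodule.map_span, Submodule.map_top, Submodule.range_subtype, ← Set.range_comp] at h2
  rw [h1]
  exact h2

variable {k L}

/-- The center of the enveloping algebra of a current Lie algebra. -/
theorem center_envelopingAlgebra {A D J : Type*} [CommRing A] [Algebra k A]
    (α : Module.Basis D k A) [LinearOrder D] [AddCommMonoid D] [IsOrderedCancelAddMonoid D]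
    (hα : ∀ r s, α r * α s = α (r + s)) (hD : ∀ F : Finset D, ∃ N, ∀ r ∈ F, ∀ s ∈ F, r < s + N)
    (e : Module.Basis J k (LieAlgebra.center k L)) :
    Subalgebra.center k (UniversalEnvelopingAlgebra k (A ⊗[k] L)) =
        Algebra.adjoin k (Set.range fun p : J × D =>
          UniversalEnvelopingAlgebra.ι k (α p.2 ⊗ₜ[k] (e p.1 : L))) ∧
      IsFreelyGeneratedBy (Subalgebra.center k (UniversalEnvelopingAlgebra k (A ⊗[k] L)))
        fun p : J × D => UniversalEnvelopingAlgebra.ι k (α p.2 ⊗ₜ[k] (e p.1 : L)) := by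
  have hspan := span_range_center_basis k L e
  have he : LinearIndependent k fun j => (e j : L) :=
    e.linearIndependent.map' (LieAlgebra.center k L).toSubmodule.subtype (Submodule.ker_subtype _)
  let Ψ := envelopingEquiv (𝓥 := tensorGrading (evenGrading k L) A) (TensorProduct.comm k A L)
    (tensorGrading_evenGrading_zero k L A) (comm_lie k L A)
  have hΨ : ∀ p : J × D, Ψ.symm (Enveloping.ι (tensorGrading (evenGrading k L) A)
      ((e p.1 : L) ⊗ₜ[k] α p.2)) = UniversalEnvelopingAlgebra.ι k (α p.2 ⊗ₜ[k] (e p.1 : L)) :=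
    fun p => by
      rw [AlgEquiv.symm_apply_eq, envelopingEquiv_ι, TensorProduct.comm_tmul]
  have hZ : Subalgebra.center k (UniversalEnvelopingAlgebra k (A ⊗[k] L)) =
      (superCenter (Enveloping.grading (tensorGrading (evenGrading k L) A))).map
        (Ψ.symm : _ →ₐ[k] UniversalEnvelopingAlgebra k (A ⊗[k] L)) := by
    rw [superCenter_eq_center_of_even (tensorGrading_evenGrading_zero k L A)]
    ext z
    rw [Subalgebra.mem_map]
    simp only [Subalgebra.mem_center_iff]
    constructor
    · refine fun h => ⟨Ψ z, fun u => Ψ.symm.injective ?_, Ψ.symm_apply_apply z⟩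
      rw [map_mul, map_mul, AlgEquiv.symm_apply_apply, h]
    · rintro ⟨w, hw, rfl⟩ u
      refine Ψ.injective ?_
      change Ψ (u * Ψ.symm w) = Ψ (Ψ.symm w * u)
      rw [map_mul, map_mul, AlgEquiv.apply_symm_apply, hw]
  constructor
  · rw [hZ, superCenter_eq_adjoin_range α hα hD hspan, AlgHom.map_adjoin, ← Set.range_comp]
    congr 2
    exact funext hΨ
  · have h1 := (isFreelyGeneratedBy_superCenter α hα hD he hspan
      (evenGrading_zero k L ▸ le_top)).map Ψ.symm
    rw [← hZ] at h1
    rwa [funext hΨ] at h1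

end LieAlgebra

end LieSuperalgebra

/-! ### Current and loop algebras -/

section Shift

theorem exists_forall_lt_add_nat (F : Finset ℕ) : ∃ N, ∀ r ∈ F, ∀ s ∈ F, r < s + N :=
  ⟨F.sup id + 1, fun r hr s _ => by
    have : r ≤ F.sup id := Finset.le_sup (f := id) hr
    omega⟩

theorem exists_forall_lt_add_int (F : Finset ℤ) : ∃ N, ∀ r ∈ F, ∀ s ∈ F, r < s + N := by
  refine ⟨2 * F.sup Int.natAbs + 1, fun r hr s hs => ?_⟩
  have h1 : r.natAbs ≤ F.sup Int.natAbs := Finset.le_sup hr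
  have h2 : s.natAbs ≤ F.sup Int.natAbs := Finset.le_sup hs
  omega

end Shift

section Monomials

variable (k : Type*) [Field k]

theorem polynomial_basisMonomials_apply (r : ℕ) :
    Polynomial.basisMonomials k r = (Polynomial.X ^ r : k[X]) := by
  rw [Polynomial.coe_basisMonomials, Polynomial.X_pow_eq_monomial]

/-- The basis of the Laurent polynomials that consists of the powers of the variable. -/
def laurentBasis : Module.Basis ℤ k k[T;T⁻¹] :=
  Module.Basis.ofRepr (AddMonoidAlgebra.coeffLinearEquiv k)

theorem laurentBasis_apply (r : ℤ) : laurentBasis k r = (LaurentPolynomial.T r : k[T;T⁻¹]) := rfl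

end Monomials

end

theorem theorem1p1 {k : Type*} [Field k] [IsAlgClosed k] [CharZero k] :
    -- Lie algebras: current algebra, then loop algebra
    (∀ (L : Type*) [LieRing L] [LieAlgebra k L] (J : Type*)
      (e : Module.Basis J k (LieAlgebra.center k L)),
      (Subalgebra.center k (UniversalEnvelopingAlgebra k (k[X] ⊗[k] L)) =
          Algebra.adjoin k (Set.range fun p : J × ℕ =>
            UniversalEnvelopingAlgebra.ι k ((Polynomial.X ^ p.2 : k[X]) ⊗ₜ[k] (e p.1 : L))) ∧
        IsFreelyGeneratedBy (Subalgebra.center k (UniversalEnvelopingAlgebra k (k[X] ⊗[k] L)))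
          fun p : J × ℕ =>
            UniversalEnvelopingAlgebra.ι k ((Polynomial.X ^ p.2 : k[X]) ⊗ₜ[k] (e p.1 : L))) ∧
      (Subalgebra.center k (UniversalEnvelopingAlgebra k (k[T;T⁻¹] ⊗[k] L)) =
          Algebra.adjoin k (Set.range fun p : J × ℤ =>
            UniversalEnvelopingAlgebra.ι k
              ((LaurentPolynomial.T p.2 : k[T;T⁻¹]) ⊗ₜ[k] (e p.1 : L))) ∧
        IsFreelyGeneratedBy (Subalgebra.center k (UniversalEnvelopingAlgebra k (k[T;T⁻¹] ⊗[k] L)))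
          fun p : J × ℤ =>
            UniversalEnvelopingAlgebra.ι k
              ((LaurentPolynomial.T p.2 : k[T;T⁻¹]) ⊗ₜ[k] (e p.1 : L)))) ∧
    -- Lie superalgebras: current superalgebra, then loop superalgebra
    (∀ (L : Type*) [AddCommGroup L] [Module k L] (𝓛 : ZMod 2 → Submodule k L)
      [LieSuperalgebra 𝓛] (J : Type*) (e : Module.Basis J k (LieSuperalgebra.center 𝓛)),
      (superCenter (LieSuperalgebra.Enveloping.grading (LieSuperalgebra.tensorGrading 𝓛 k[X])) =
          Algebra.adjoin k (Set.range fun p : J × ℕ =>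
            LieSuperalgebra.Enveloping.ι (LieSuperalgebra.tensorGrading 𝓛 k[X])
              ((e p.1 : L) ⊗ₜ[k] (Polynomial.X ^ p.2 : k[X]))) ∧
        (LieSuperalgebra.center 𝓛 ≤ 𝓛 0 →
          IsFreelyGeneratedBy
            (superCenter
              (LieSuperalgebra.Enveloping.grading (LieSuperalgebra.tensorGrading 𝓛 k[X])))
            fun p : J × ℕ =>
              LieSuperalgebra.Enveloping.ι (LieSuperalgebra.tensorGrading 𝓛 k[X])
                ((e p.1 : L) ⊗ₜ[k] (Polynomial.X ^ p.2 : k[X])))) ∧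
      (superCenter
            (LieSuperalgebra.Enveloping.grading (LieSuperalgebra.tensorGrading 𝓛 k[T;T⁻¹])) =
          Algebra.adjoin k (Set.range fun p : J × ℤ =>
            LieSuperalgebra.Enveloping.ι (LieSuperalgebra.tensorGrading 𝓛 k[T;T⁻¹])
              ((e p.1 : L) ⊗ₜ[k] (LaurentPolynomial.T p.2 : k[T;T⁻¹]))) ∧
        (LieSuperalgebra.center 𝓛 ≤ 𝓛 0 →
          IsFreelyGeneratedBy
            (superCenter
              (LieSuperalgebra.Enveloping.grading (LieSuperalgebra.tensorGrading 𝓛 k[T;T⁻¹])))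
            fun p : J × ℤ =>
              LieSuperalgebra.Enveloping.ι (LieSuperalgebra.tensorGrading 𝓛 k[T;T⁻¹])
                ((e p.1 : L) ⊗ₜ[k] (LaurentPolynomial.T p.2 : k[T;T⁻¹]))))) := by
  have hα : ∀ r s, Polynomial.basisMonomials k r * Polynomial.basisMonomials k s =
      Polynomial.basisMonomials k (r + s) := fun r s => by
    simp only [polynomial_basisMonomials_apply, pow_add]
  have hα' : ∀ r s, laurentBasis k r * laurentBasis k s = laurentBasis k (r + s) := fun r s => by
    simp only [laurentBasis_apply, LaurentPolynomial.T_add]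
  refine ⟨fun L _ _ J e => ⟨?_, ?_⟩, fun L _ _ 𝓛 _ J e => ?_⟩
  · have h := LieSuperalgebra.center_envelopingAlgebra (Polynomial.basisMonomials k) hα
      exists_forall_lt_add_nat e
    simp only [polynomial_basisMonomials_apply] at h
    exact h
  · have h := LieSuperalgebra.center_envelopingAlgebra (laurentBasis k) hα'
      exists_forall_lt_add_int e
    simp only [laurentBasis_apply] at h
    exact h
  · have he : LinearIndependent k fun j => (e j : L) :=
      e.linearIndependent.map' (LieSuperalgebra.center 𝓛).subtype (Submodule.ker_subtype _)
    have hspan : Submodule.span k (Set.range fun j => (e j : L)) = LieSuperalgebra.center 𝓛 := by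
      have h := congrArg (Submodule.map (LieSuperalgebra.center 𝓛).subtype) e.span_eq
      rwa [Submodule.map_span, Submodule.map_top, Submodule.range_subtype, ← Set.range_comp] at h
    refine ⟨⟨?_, fun heven => ?_⟩, ?_, fun heven => ?_⟩
    · have h := LieSuperalgebra.superCenter_eq_adjoin_range (Polynomial.basisMonomials k) hα
        exists_forall_lt_add_nat hspan
      simp only [polynomial_basisMonomials_apply] at h
      exact h
    · have h := LieSuperalgebra.isFreelyGeneratedBy_superCenter (Polynomial.basisMonomials k) hα
        exists_forall_lt_add_nat he hspan heven
      simp only [polynomial_basisMonomials_apply] at h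
      exact h
    · have h := LieSuperalgebra.superCenter_eq_adjoin_range (laurentBasis k) hα'
        exists_forall_lt_add_int hspan
      simp only [laurentBasis_apply] at h
      exact h
    · have h := LieSuperalgebra.isFreelyGeneratedBy_superCenter (laurentBasis k) hα'
        exists_forall_lt_add_int he hspan heven
      simp only [laurentBasis_apply] at h
      exact h
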